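/- Let $\Omega$ be a locally compact second countable Hausdorff space, $\mathcal H$ a complex separable Hilbert space and $\mathcal L(\mathcal H)$ the bounded operators on $\mathcal H$. Let $C_0(\Omega)$ be the space of continuous complex functions on $\Omega$ vanishing at infinity, and let $B(\Omega)^+$ be the set of positive Borel measures $\nu$ on $\Omega$ with $\nu(\Omega)\le 1$, endowed with the weak*-topology, that is, the coarsest topology for which all maps $\nu\mapsto\nu(f):=\int_\Omega f\,d\nu$, $f\in C_0(\Omega)$, are continuous. A positive operator valued measure (POVM) on $\Omega$ is regarded as a linear map $E:C_0(\Omega)\to\mathcal L(\mathcal H)$ such that $E(f)\ge 0$ if $f\ge 0$, and such that $E(f_n)\uparrow I$ whenever $0\le f_n\uparrow 1$ pointwise with $f_n\in C_0(\Omega)$. It is commutative if the operators $E(f)$, $f\in C_0(\Omega)$, commute with each other; $E'$ denotes the commutant of $\{E(f)\mid f\in C_0(\Omega)\}$ in $\mathcal L(\mathcal H)$. A projection valued measure (PVM) on a compact metrizable space $\Sigma$ is a map $P$ from the Borel sets of $\Sigma$ to the positive operators on $\mathcal H$ that is countably additive in the weak operator topology, with $P(\Sigma)=I$ and $P(X)P(Y)=P(X\cap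 Y)$ for all Borel sets $X,Y$. Its support $\operatorname{supp}P$ is the set of the points all of whose open neighbourhoods $U$ have $P(U)\neq 0$. For $\phi\in C(\Sigma)$ the operator $P(\phi)=\int_\Sigma\phi\,dP$ is given by $\langle\psi,P(\phi)\psi\rangle=\int_\Sigma\phi(h)\,\langle\psi,P(dh)\psi\rangle$ for all $\psi\in\mathcal H$, and $P'$ denotes the commutant of $\{P(\phi)\mid\phi\in C(\Sigma)\}$ in $\mathcal L(\mathcal H)$. **Theorem.** Let $E:C_0(\Omega)\to\mathcal L(\mathcal H)$ be a commutative POVM. Then there exists a triple $(\Sigma,P,\mu)$ such that (i) $\Sigma$ is a compact metrizable space (possibly empty, which occurs only if $\mathcal H=0$); (ii) $P$ is a PVM on $\Sigma$ with values in $\mathcal L(\mathcal H)$ and $\operatorname{supp}P=\Sigma$; (iii) $\mu:\Sigma\to B(\Omega)^+$ is a weak*-continuous injective map; (iv) for all $f\in C_0(\Omega)$, $$E(f)=\int_\Sigma[\mu(h)](f)\,dP(h).$$ If $(\tilde\Sigma,\tilde P,\tilde\mu)$ is another triple satisfying (i)–(iv), then there exists a homeomorphism $\Phi:\Sigma\to\tilde\Sigma$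 such that $\tilde P(X)=P(\Phi^{-1}(X))$ for all Borel sets $X\subseteq\tilde\Sigma$ and $\mu=\tilde\mu\circ\Phi$. Moreover, $P'=E'$. -/

import Mathlib

open MeasureTheory Topology Filter
open scoped ZeroAtInfty ComplexOrder ENNReal

universe u v w

noncomputable section

/-- A positive operator valued measure on a measurable space `X` with values in `H`, as a
set function (its values on non-measurable sets are irrelevant). Countable additivity is with
respect to the weak operator topology. -/
structure POVM (X H : Type*) [MeasurableSpace X] [NormedAddCommGroup H]
    [InnerProductSpace ℂ H] [CompleteSpace H] where
  toFun : Set X → (H →L[ℂ] H)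
  isPositive : ∀ A, MeasurableSet A → (toFun A).IsPositive
  univ : toFun Set.univ = 1
  hasSum_iUnion : ∀ A : ℕ → Set X, (∀ i, MeasurableSet (A i)) →
    Pairwise (fun i j => Disjoint (A i) (A j)) →
    ∀ u v : H, HasSum (fun i => inner ℂ u (toFun (A i) v)) (inner ℂ u (toFun (⋃ i, A i) v))

/-- A projection valued measure (sharp observable). -/
structure PVM (X H : Type*) [MeasurableSpace X] [NormedAddCommGroup H]
    [InnerProductSpace ℂ H] [CompleteSpace H] extends POVM X H where
  mul_eq : ∀ A B, MeasurableSet A → MeasurableSet B → toFun A * toFun B = toFun (A ∩ B)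

namespace POVM

variable {X H : Type*} [MeasurableSpace X] [NormedAddCommGroup H]
  [InnerProductSpace ℂ H] [CompleteSpace H]

lemma toFun_empty (P : POVM X H) : P.toFun ∅ = 0 := by
  ext v
  refine ext_inner_left ℂ fun u => ?_
  have h := P.hasSum_iUnion (fun _ => ∅) (fun _ => MeasurableSet.empty)
    (fun _ _ _ => disjoint_bot_left) u v
  have h0 := h.summable.tendsto_atTop_zero
  simpa using tendsto_nhds_unique tendsto_const_nhds h0

/-- The measure `A ↦ ⟪ψ, P(A) ψ⟫`. -/
def vecMeasure (P : POVM X H) (ψ : H) : Measure X :=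
  Measure.ofMeasurable (fun A _ => ENNReal.ofReal (inner ℂ ψ (P.toFun A ψ)).re)
    (by simp [P.toFun_empty])
    (by
      intro A hA hd
      have h := Complex.hasSum_re (P.hasSum_iUnion A hA hd ψ ψ)
      rw [← h.tsum_eq, ENNReal.ofReal_tsum_of_nonneg _ h.summable]
      intro i
      exact (P.isPositive (A i) (hA i)).re_inner_nonneg_right ψ)

/-- `P.IsIntegral φ T` says that `T = ∫ φ dP`, in the weak sense:
`⟪ψ, T ψ⟫ = ∫ φ(x) ⟪ψ, P(dx) ψ⟫` for every vector `ψ`. For a bounded measurable `φ` there is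
exactly one such operator `T`. -/
def IsIntegral (P : POVM X H) (φ : X → ℂ) (T : H →L[ℂ] H) : Prop :=
  ∀ ψ : H, inner ℂ ψ (T ψ) = ∫ x, φ x ∂(P.vecMeasure ψ)

/-- The closed support. -/
def support [TopologicalSpace X] (P : POVM X H) : Set X :=
  {x | ∀ U : Set X, IsOpen U → x ∈ U → P.toFun U ≠ 0}

/-- The commutant `P'` of the set of operators `∫ φ dP`, `φ ∈ C₀(X)`. -/
def commutant [TopologicalSpace X] (P : POVM X H) : Set (H →L[ℂ] H) :=
  Set.centralizer {T | ∃ φ : C₀(X, ℂ), P.IsIntegral φ T}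

end POVM

/-- A positive operator valued measure on a locally compact second countable Hausdorff space,
as a positive linear map on `C₀(Ω)` with `E(fₙ) ↑ I` whenever `0 ≤ fₙ ↑ 1`. (Monotonicity of
`E(fₙ)` is a consequence of positivity.) -/
structure FunctionalPOVM (Ω H : Type*) [TopologicalSpace Ω] [NormedAddCommGroup H]
    [InnerProductSpace ℂ H] [CompleteSpace H] where
  toLinearMap : C₀(Ω, ℂ) →ₗ[ℂ] (H →L[ℂ] H)
  isPositive : ∀ f : C₀(Ω, ℂ), (∀ x, 0 ≤ f x) → (toLinearMap f).IsPositive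
  tendsto_one : ∀ f : ℕ → C₀(Ω, ℂ), (∀ n x, 0 ≤ f n x) → (∀ x, Monotone fun n => f n x) →
    (∀ x, Tendsto (fun n => f n x) atTop (𝓝 1)) →
    ∀ u v : H, Tendsto (fun n => inner ℂ u (toLinearMap (f n) v)) atTop (𝓝 (inner ℂ u v))

namespace FunctionalPOVM

variable {Ω H : Type*} [TopologicalSpace Ω] [NormedAddCommGroup H]
  [InnerProductSpace ℂ H] [CompleteSpace H]

/-- The commutant `E'` of the set of operators `E(f)`, `f ∈ C₀(Ω)`. -/
def commutant (E : FunctionalPOVM Ω H) : Set (H →L[ℂ] H) :=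
  Set.centralizer (Set.range E.toLinearMap)

/-- Commutativity of a positive operator valued measure. -/
def IsCommutative (E : FunctionalPOVM Ω H) : Prop :=
  ∀ f, E.toLinearMap f ∈ E.commutant

end FunctionalPOVM

/-- The positive part `B(Ω)⁺` of the unit ball of the space of complex Borel measures on `Ω`:
the positive measures of total mass at most one. -/
def PosBall (Ω : Type*) [MeasurableSpace Ω] : Type _ :=
  {ν : Measure Ω // ν Set.univ ≤ 1}

/-- The pairing `ν(f) = ∫ f dν`. -/
def PosBall.pairing {Ω : Type*} [TopologicalSpace Ω] [MeasurableSpace Ω] (ν : PosBall Ω)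
    (f : C₀(Ω, ℂ)) : ℂ :=
  ∫ x, f x ∂ν.1

/-- The weak* topology, i.e. the coarsest one for which all `ν ↦ ν(f)`, `f ∈ C₀(Ω)`, are
continuous. -/
instance {Ω : Type*} [TopologicalSpace Ω] [MeasurableSpace Ω] : TopologicalSpace (PosBall Ω) :=
  TopologicalSpace.induced (fun ν (f : C₀(Ω, ℂ)) => ν.pairing f) inferInstance

/-- The conditions on a triple `(S, P, μ)`, where `S` is a compact metrizable space and `P` is
a projection valued measure on its Borel sets, to represent `E`. -/
structure FunctionalPOVM.IsRepresentation {Ω S H : Type*} [TopologicalSpace Ω]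
    [MeasurableSpace Ω] [NormedAddCommGroup H] [InnerProductSpace ℂ H] [CompleteSpace H]
    [TopologicalSpace S] [MeasurableSpace S]
    (E : FunctionalPOVM Ω H) (P : PVM S H) (μ : S → PosBall Ω) : Prop where
  support_eq : P.support = Set.univ
  continuous : Continuous μ
  injective : Function.Injective μ
  isIntegral : ∀ f : C₀(Ω, ℂ), P.IsIntegral (fun h => (μ h).pairing f) (E.toLinearMap f)

end

/-! Existence rests on Gelfand duality for the double commutant `E''`. Commutativity of `E` makes it
a commutative C*-algebra, so `E'' ≅ C(Z)` with `Z` its character space. For a character `χ`, the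
functional `f ↦ χ(E(f))` is positive and bounded by one, hence is integration against a measure
`m(χ)` of mass at most one (`exists_measure_of_positive`). The map `m` is weak*-continuous, so its
range `K` is compact, and metrizable because countably many `f` separate measures. Pulling functions
back along `m` embeds `C(K)` in `C(Z) ≅ E''` and sends `ν ↦ ν(f)` to `E(f)`. The spectral theorem
(`exists_PVM_of_starAlgHom`) turns this representation into a PVM on `K`. Its support is full
because the representation is injective, and `μ` is the inclusion. The represented operators contain
every `E(f)` and lie in `E''`, so `P' = E'`.

For uniqueness, both PVMs are pushed forward to the compact union of the images of the two maps into
measures. Integration against a PVM is multiplicative, so the functions with equal integrals form a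
star algebra; it contains the pairings, which separate points. By Stone–Weierstrass the two images
coincide, and full support forces both maps to be onto, hence homeomorphisms. -/

noncomputable section

/-! ### Quadratic forms and weak operator limits -/

section WeakOperator

variable {H : Type*} [NormedAddCommGroup H] [InnerProductSpace ℂ H]

lemma inner_map_eq_sum_inner_map_self (T : H →L[ℂ] H) (x y : H) :
    inner ℂ x (T y) = (inner ℂ (x + y) (T (x + y)) - inner ℂ (x - y) (T (x - y))
      - Complex.I * inner ℂ (x + Complex.I • y) (T (x + Complex.I • y))
      + Complex.I * inner ℂ (x - Complex.I • y) (T (x - Complex.I • y))) / 4 := by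
  simp only [map_add, map_sub, map_smul, inner_add_left, inner_add_right, inner_sub_left,
    inner_sub_right, inner_smul_left, inner_smul_right, Complex.conj_I]
  ring_nf
  simp only [Complex.I_sq]
  ring

/-- Operators with the same quadratic form are equal. -/
lemma ContinuousLinearMap.ext_inner_self {T T' : H →L[ℂ] H}
    (h : ∀ ψ, inner ℂ ψ (T ψ) = inner ℂ ψ (T' ψ)) : T = T' := by
  ext v
  refine ext_inner_left ℂ fun u => ?_
  rw [inner_map_eq_sum_inner_map_self T, inner_map_eq_sum_inner_map_self T' u v]
  simp only [h]

/-- By polarization, weak operator convergence can be checked on quadratic forms, the only data that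
the scalar measures supply. -/
lemma tendsto_inner_of_tendsto_inner_self {ι : Type*} {l : Filter ι} {T : ι → H →L[ℂ] H}
    {T' : H →L[ℂ] H}
    (h : ∀ ψ, Tendsto (fun n => inner ℂ ψ (T n ψ)) l (𝓝 (inner ℂ ψ (T' ψ)))) (x y : H) :
    Tendsto (fun n => inner ℂ x (T n y)) l (𝓝 (inner ℂ x (T' y))) := by
  simp only [inner_map_eq_sum_inner_map_self _ x y]
  exact (((h _).sub (h _)).sub ((h _).const_mul _) |>.add ((h _).const_mul _)).div_const _

lemma norm_inner_map_le_of_inner_self {T : H →L[ℂ] H} {C : ℝ}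
    (h : ∀ ψ, ‖inner ℂ ψ (T ψ)‖ ≤ C * ‖ψ‖ ^ 2) (x y : H) :
    ‖inner ℂ x (T y)‖ ≤ C * (‖x‖ ^ 2 + ‖y‖ ^ 2) := by
  have p1 := parallelogram_law_with_norm ℂ x y
  have p2 := parallelogram_law_with_norm ℂ x (Complex.I • y)
  rw [norm_smul, Complex.norm_I, one_mul] at p2
  have h1 := h (x + y)
  have h2 := h (x - y)
  have h3 := h (x + Complex.I • y)
  have h4 := h (x - Complex.I • y)
  rw [inner_map_eq_sum_inner_map_self, norm_div, RCLike.norm_ofNat, div_le_iff₀ (by norm_num)]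
  refine (norm_add_le _ _).trans ?_
  refine (add_le_add_left ((norm_sub_le _ _).trans (add_le_add_left (norm_sub_le _ _) _)) _).trans ?_
  rw [norm_mul, norm_mul, Complex.norm_I, one_mul, one_mul]
  refine (add_le_add (add_le_add (add_le_add h1 h2) h3) h4).trans (le_of_eq ?_)
  linear_combination C * p1 + C * p2

lemma norm_map_le_of_inner_self {T : H →L[ℂ] H} {C : ℝ}
    (h : ∀ ψ, ‖inner ℂ ψ (T ψ)‖ ≤ C * ‖ψ‖ ^ 2) (y : H) : ‖T y‖ ≤ 2 * C * ‖y‖ := by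
  rcases eq_or_ne (T y) 0 with h0 | h0
  · rcases eq_or_ne y 0 with rfl | hy
    · simp
    · have := (norm_nonneg _).trans (h y)
      have hC : 0 ≤ C := nonneg_of_mul_nonneg_left this (by positivity)
      rw [h0, norm_zero]
      positivity
  · have hy : y ≠ 0 := by rintro rfl; simp at h0
    have hT : 0 < ‖T y‖ := norm_pos_iff.2 h0
    have hy' : 0 < ‖y‖ := norm_pos_iff.2 hy
    -- The test vector is `T y` rescaled to norm `‖y‖`, which balances the two terms of the bound.
    have := norm_inner_map_le_of_inner_self h (((‖y‖ / ‖T y‖ : ℝ) : ℂ) • T y) y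
    rw [inner_smul_left, Complex.conj_ofReal, norm_mul, inner_self_eq_norm_sq_to_K, norm_smul,
      Complex.norm_real, Real.norm_of_nonneg (by positivity), norm_pow] at this
    simp only [Complex.coe_algebraMap, Complex.norm_real, norm_norm] at this
    rw [div_mul_cancel₀ _ hT.ne'] at this
    have e : ‖y‖ / ‖T y‖ * ‖T y‖ ^ 2 = ‖y‖ * ‖T y‖ := by field_simp
    rw [e] at this
    have : ‖y‖ * ‖T y‖ ≤ ‖y‖ * (2 * C * ‖y‖) := by linarith
    exact le_of_mul_le_mul_left this hy'

/-- A sequence of operators whose quadratic forms are uniformly bounded and converge has a weak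
limit. -/
lemma exists_inner_self_eq_of_tendsto [CompleteSpace H] {T : ℕ → H →L[ℂ] H} {C : ℝ} {q : H → ℂ}
    (hC : ∀ n ψ, ‖inner ℂ ψ (T n ψ)‖ ≤ C * ‖ψ‖ ^ 2)
    (hq : ∀ ψ, Tendsto (fun n => inner ℂ ψ (T n ψ)) atTop (𝓝 (q ψ))) :
    ∃ T' : H →L[ℂ] H, ∀ ψ, inner ℂ ψ (T' ψ) = q ψ := by
  have hlim : ∀ x y, ∃ b, Tendsto (fun n => inner ℂ x (T n y)) atTop (𝓝 b) := by
    intro x y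
    simp only [inner_map_eq_sum_inner_map_self _ x y]
    exact ⟨_, (((hq _).sub (hq _)).sub ((hq _).const_mul _) |>.add
      ((hq _).const_mul _)).div_const _⟩
  choose b hb using hlim
  let B : H →ₗ⋆[ℂ] H →ₗ[ℂ] ℂ := LinearMap.mk₂'ₛₗ (starRingEnd ℂ) (RingHom.id ℂ) b
    (fun x x' y => tendsto_nhds_unique (hb _ _)
      (((hb x y).add (hb x' y)).congr fun n => (inner_add_left _ _ _).symm))
    (fun c x y => tendsto_nhds_unique (hb _ _)
      (((hb x y).const_mul _).congr fun n => (inner_smul_left _ _ _).symm))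
    (fun x y y' => tendsto_nhds_unique (hb _ _)
      (((hb x y).add (hb x y')).congr fun n => by rw [map_add, inner_add_right]))
    (fun c x y => tendsto_nhds_unique (hb _ _)
      (((hb x y).const_mul _).congr fun n => by
        rw [map_smul, inner_smul_right, RingHom.id_apply]))
  have hB : ∀ x y, ‖B x y‖ ≤ 2 * C * ‖x‖ * ‖y‖ := fun x y => by
    refine le_of_tendsto (hb x y).norm (Eventually.of_forall fun n => ?_)
    refine (norm_inner_le_norm _ _).trans ?_
    refine (mul_le_mul_of_nonneg_left (norm_map_le_of_inner_self (hC n) y)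
      (norm_nonneg _)).trans (le_of_eq (by ring))
  -- `continuousLinearMapOfBilin` puts its operator in the left slot of the inner product; the
  -- adjoint moves it to the right one.
  refine ⟨ContinuousLinearMap.adjoint
    (InnerProductSpace.continuousLinearMapOfBilin (B.mkContinuous₂ _ hB)), fun ψ => ?_⟩
  rw [ContinuousLinearMap.adjoint_inner_right,
    InnerProductSpace.continuousLinearMapOfBilin_apply]
  exact tendsto_nhds_unique (hb ψ ψ) (hq ψ)

end WeakOperator

/-! ### Riesz representation on `C₀(X)` -/

section RieszMarkov

open scoped CompactlySupported

variable {X : Type*} [TopologicalSpace X]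

/-- A real function vanishing at infinity, regarded as a complex one. -/
def ZeroAtInftyContinuousMap.complexify : C₀(X, ℝ) →ₗ[ℝ] C₀(X, ℂ) where
  toFun r :=
    { toFun := fun x => (r x : ℂ)
      continuous_toFun := Complex.continuous_ofReal.comp (map_continuous r)
      zero_at_infty' := by
        have := (Complex.continuous_ofReal.tendsto 0).comp (zero_at_infty r)
        rwa [Complex.ofReal_zero] at this }
  map_add' r s := by ext x; simp
  map_smul' c r := by ext x; simp

open ZeroAtInftyContinuousMap

@[simp]
lemma ZeroAtInftyContinuousMap.complexify_apply (r : C₀(X, ℝ)) (x : X) :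
    complexify r x = (r x : ℂ) := rfl

/-- Composition with a continuous real function fixing zero. -/
def ZeroAtInftyContinuousMap.mapReal {Y : Type*} [TopologicalSpace Y] [Zero Y] (p : C(Y, ℝ))
    (hp : p 0 = 0) (f : C₀(X, Y)) : C₀(X, ℝ) where
  toFun x := p (f x)
  continuous_toFun := p.continuous.comp (map_continuous f)
  zero_at_infty' := by
    have := (p.continuous.tendsto 0).comp (zero_at_infty f)
    rwa [hp] at this

@[simp]
lemma ZeroAtInftyContinuousMap.mapReal_apply {Y : Type*} [TopologicalSpace Y] [Zero Y]
    (p : C(Y, ℝ)) (hp : p 0 = 0) (f : C₀(X, Y)) (x : X) : mapReal p hp f x = p (f x) := rfl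

/-- Every function in `C₀(X, ℂ)` is a linear combination of non-negative functions. -/
lemma ZeroAtInftyContinuousMap.exists_eq_complexify (f : C₀(X, ℂ)) :
    ∃ a b c d : C₀(X, ℝ), (∀ x, 0 ≤ a x) ∧ (∀ x, 0 ≤ b x) ∧ (∀ x, 0 ≤ c x) ∧ (∀ x, 0 ≤ d x) ∧
      f = complexify a - complexify b + Complex.I • (complexify c - complexify d) := by
  refine ⟨mapReal ⟨fun z : ℂ => max z.re 0, by fun_prop⟩ (by simp) f,
    mapReal ⟨fun z : ℂ => max (-z.re) 0, by fun_prop⟩ (by simp) f,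
    mapReal ⟨fun z : ℂ => max z.im 0, by fun_prop⟩ (by simp) f,
    mapReal ⟨fun z : ℂ => max (-z.im) 0, by fun_prop⟩ (by simp) f,
    fun x => le_max_right _ _, fun x => le_max_right _ _, fun x => le_max_right _ _,
    fun x => le_max_right _ _, ?_⟩
  have key : ∀ t : ℝ, max t 0 - max (-t) 0 = t := fun t => by
    rcases le_total t 0 with h | h <;> simp [h]
  ext x
  apply Complex.ext
  · simp [key]
  · simp [key]

variable [MeasurableSpace X] [BorelSpace X]

lemma ZeroAtInftyContinuousMap.integrable {F : Type*} [NormedAddCommGroup F]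
    [SecondCountableTopology F] [MeasurableSpace F] [BorelSpace F]
    {ν : Measure X} [IsFiniteMeasure ν] (f : C₀(X, F)) : Integrable f ν := by
  refine Integrable.of_bound (map_continuous f).measurable.aestronglyMeasurable ‖f‖
    (Eventually.of_forall fun x => ?_)
  rw [← norm_toBCF_eq_norm]
  exact f.toBCF.norm_coe_le_norm x

variable [T2Space X] [LocallyCompactSpace X]

/-- **Riesz–Markov–Kakutani** for bounded positive functionals on `C₀(X, ℂ)`. -/
theorem exists_measure_of_positive (Λ : C₀(X, ℂ) →ₗ[ℂ] ℂ) (C : ℝ)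
    (hpos : ∀ f : C₀(X, ℂ), (∀ x, 0 ≤ f x) → 0 ≤ Λ f)
    (hC : ∀ f : C₀(X, ℂ), (∀ x, 0 ≤ f x) → (∀ x, f x ≤ 1) → ‖Λ f‖ ≤ C) :
    ∃ ν : Measure X, ν Set.univ ≤ ENNReal.ofReal C ∧ ∀ f : C₀(X, ℂ), Λ f = ∫ x, f x ∂ν := by
  let ι : C_c(X, ℝ) →ₗ[ℝ] C₀(X, ℝ) :=
    { toFun := fun f => (f : C₀(X, ℝ))
      map_add' := fun f g => by ext x; rfl
      map_smul' := fun c f => by ext x; rfl }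
  have hι : ∀ f x, ι f x = f x := fun f x => rfl
  let L : C_c(X, ℝ) →ₚ[ℝ] ℝ := PositiveLinearMap.mk₀
    (Complex.reLm ∘ₗ (Λ.restrictScalars ℝ) ∘ₗ complexify ∘ₗ ι)
    (fun f hf => (Complex.le_def.1 (hpos _ fun x => by
      simpa [hι] using hf x)).1)
  have hL : ∀ f : C_c(X, ℝ), L f = (Λ (complexify (ι f))).re := fun f => rfl
  let ν := RealRMK.rieszMeasure L
  have hν : ν Set.univ ≤ ENNReal.ofReal C := by
    -- By inner regularity it suffices to bound compact sets; each is dominated by a bump function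
    -- with values in `[0, 1]`, to which `hC` applies.
    rw [isOpen_univ.measure_eq_iSup_isCompact ν]
    refine iSup_le fun K => iSup_le fun _ => iSup_le fun hK => ?_
    obtain ⟨f, hf1, hf2, -, hf3⟩ :=
      exists_continuousMap_one_of_isCompact_subset_isOpen hK isOpen_univ (Set.subset_univ _)
    let f' : C_c(X, ℝ) := ⟨f, hf2⟩
    refine (RealRMK.rieszMeasure_le_of_eq_one L (f := f') (fun x => (hf3 x).1) hK
      (fun x hx => hf1 hx)).trans (ENNReal.ofReal_le_ofReal ?_)
    rw [hL]
    refine (Complex.re_le_norm _).trans (hC _ (fun x => ?_) (fun x => ?_))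
    · exact Complex.zero_le_real.2 (hf3 x).1
    · have : f' x ≤ 1 := (hf3 x).2
      simpa [hι] using (Complex.real_le_real.2 this)
  have : IsFiniteMeasure ν := ⟨hν.trans_lt ENNReal.ofReal_lt_top⟩
  have hC0 : 0 ≤ C := (norm_nonneg _).trans (hC 0 (fun x => le_rfl) (fun x => by simp))
  have hνr : ν.real Set.univ ≤ C := ENNReal.toReal_le_of_le_ofReal hC0 hν
  have hreal : ∀ f : C₀(X, ℂ), (∀ x, 0 ≤ f x) → Λ f = ((Λ f).re : ℂ) := fun f hf =>
    Complex.ext (by simp) (by simpa using (Complex.le_def.1 (hpos f hf)).2.symm)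
  have hr : ∀ r : C₀(X, ℝ), (∀ x, 0 ≤ r x) → Λ (complexify r) = ∫ x, complexify r x ∂ν := by
    intro r hr
    have hle : ∀ ε > 0, ‖Λ (complexify r) - ∫ x, complexify r x ∂ν‖ ≤ 2 * C * ε := by
      intro ε hε
      -- Truncation at height `ε`: the remainder `r - s` has compact support, where the Riesz
      -- theorem applies, while `s` contributes at most `C * ε` to either side.
      let s : C₀(X, ℝ) := mapReal ⟨fun t => min t ε, by fun_prop⟩ (by simp [hε.le]) r
      have hs : ∀ x, s x = min (r x) ε := fun x => rfl
      have hs0 : ∀ x, 0 ≤ s x := fun x => le_min (hr x) hε.le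
      let t : C_c(X, ℝ) :=
        { toFun := fun x => r x - s x
          continuous_toFun := (map_continuous r).sub (map_continuous s)
          hasCompactSupport' := by
            have := (zero_at_infty r).eventually (gt_mem_nhds hε)
            obtain ⟨K, hK, hKs⟩ := mem_cocompact.1 this
            refine HasCompactSupport.intro hK fun x hx => ?_
            have : r x < ε := hKs hx
            simp [hs, this.le] }
      have ht0 : ∀ x, 0 ≤ t x := fun x => sub_nonneg.2 (min_le_left _ _)
      have hrt : r = ι t + s := by
        ext x
        change r x = (r x - s x) + s x
        ring
      have h1 : Λ (complexify (ι t)) = ∫ x, complexify (ι t) x ∂ν := by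
        rw [hreal _ (fun x => by simpa [hι] using ht0 x), ← hL,
          ← RealRMK.integral_rieszMeasure L t, ← integral_complex_ofReal]
        rfl
      have h2 : ‖Λ (complexify s)‖ ≤ C * ε := by
        have := hC (complexify (ε⁻¹ • s)) (fun x => ?_) (fun x => ?_)
        · rw [map_smul, show ε⁻¹ • complexify s = ((ε⁻¹ : ℝ) : ℂ) • complexify s from rfl,
            map_smul, norm_smul, Complex.norm_real,
            Real.norm_of_nonneg (by positivity), inv_mul_le_iff₀ hε] at this
          linarith
        · rw [complexify_apply, Complex.zero_le_real]
          exact mul_nonneg (by positivity) (hs0 x)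
        · rw [complexify_apply, ← Complex.ofReal_one, Complex.real_le_real]
          change ε⁻¹ * s x ≤ 1
          rw [inv_mul_le_iff₀ hε, mul_one]
          exact min_le_right _ _
      have h3 : ‖∫ x, complexify s x ∂ν‖ ≤ C * ε := by
        refine (norm_integral_le_of_norm_le_const (C := ε) (Eventually.of_forall fun x => ?_)).trans
          ?_
        · rw [complexify_apply, Complex.norm_real, Real.norm_of_nonneg (hs0 x)]
          exact min_le_right _ _
        · rw [mul_comm]
          exact mul_le_mul_of_nonneg_right hνr hε.le
      have h4 : ∫ x, complexify r x ∂ν = ∫ x, complexify (ι t) x ∂ν + ∫ x, complexify s x ∂ν := by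
        rw [← integral_add (ZeroAtInftyContinuousMap.integrable _)
          (ZeroAtInftyContinuousMap.integrable _)]
        refine integral_congr_ae (Eventually.of_forall fun x => ?_)
        simp only [complexify_apply]
        nth_rewrite 1 [hrt]
        simp
      have h5 : Λ (complexify r) = Λ (complexify (ι t)) + Λ (complexify s) := by
        rw [← map_add, ← map_add, ← hrt]
      rw [h4, h5, h1, add_sub_add_left_eq_sub]
      refine (norm_sub_le _ _).trans ?_
      linarith
    have : Tendsto (fun ε : ℝ => 2 * C * ε) (𝓝[>] 0) (𝓝 0) := by
      have : Tendsto (fun ε : ℝ => 2 * C * ε) (𝓝 0) (𝓝 (2 * C * 0)) :=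
        (continuous_const.mul continuous_id).tendsto 0
      rw [mul_zero] at this
      exact this.mono_left nhdsWithin_le_nhds
    have := ge_of_tendsto this (eventually_mem_nhdsWithin.mono fun ε hε => hle ε hε)
    exact sub_eq_zero.1 (norm_le_zero_iff.1 this)
  refine ⟨ν, hν, fun f => ?_⟩
  obtain ⟨a, b, c, d, ha, hb, hc, hd, rfl⟩ := exists_eq_complexify f
  have hInt : ∀ g : C₀(X, ℂ), Integrable g ν := fun g => g.integrable
  have hsub : ∀ p q : C₀(X, ℂ), ∫ x, (p - q) x ∂ν = ∫ x, p x ∂ν - ∫ x, q x ∂ν := fun p q =>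
    integral_sub (hInt p) (hInt q)
  have hadd : ∀ p q : C₀(X, ℂ),
      ∫ x, (p + Complex.I • q) x ∂ν = ∫ x, p x ∂ν + Complex.I * ∫ x, q x ∂ν := fun p q => by
    rw [← integral_const_mul, ← integral_add (hInt p) ((hInt q).const_mul _)]
    rfl
  rw [hadd, hsub, hsub, map_add, map_smul, map_sub, map_sub, hr a ha, hr b hb, hr c hc, hr d hd,
    smul_eq_mul]

end RieszMarkov

/-! ### Approximate units and countable families separating measures -/

section Separation

open ZeroAtInftyContinuousMap

variable {X : Type*} [TopologicalSpace X] [T2Space X] [LocallyCompactSpace X]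
  [SecondCountableTopology X]

/-- The indicator of an open set is a bounded pointwise limit of functions vanishing at
infinity. -/
lemma exists_seq_tendsto_indicator {U : Set X} (hU : IsOpen U) :
    ∃ f : ℕ → C₀(X, ℝ), (∀ n x, f n x ∈ Set.Icc (0 : ℝ) 1) ∧
      ∀ x, Tendsto (fun n => f n x) atTop (𝓝 (U.indicator 1 x)) := by
  have : LocallyCompactSpace U := hU.locallyCompactSpace
  have hK : ∀ n, IsCompact (Subtype.val '' compactCovering U n) := fun n =>
    (isCompact_compactCovering U n).image continuous_subtype_val
  have hKU : ∀ n, Subtype.val '' compactCovering U n ⊆ U := fun n => by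
    rintro _ ⟨x, -, rfl⟩
    exact x.2
  choose f hf1 hf2 hf3 hf4 using fun n =>
    exists_continuousMap_one_of_isCompact_subset_isOpen (hK n) hU (hKU n)
  refine ⟨fun n => ⟨f n, HasCompactSupport.is_zero_at_infty (hf2 n)⟩, fun n x => hf4 n x,
    fun x => ?_⟩
  by_cases hx : x ∈ U
  · obtain ⟨N, hN⟩ := exists_mem_compactCovering (⟨x, hx⟩ : U)
    rw [Set.indicator_of_mem hx]
    refine tendsto_const_nhds.congr' ?_
    filter_upwards [eventually_ge_atTop N] with n hn
    exact (hf1 n ⟨⟨x, hx⟩, compactCovering_subset U hn hN, rfl⟩).symm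
  · rw [Set.indicator_of_notMem hx]
    refine tendsto_const_nhds.congr fun n => ?_
    exact (image_eq_zero_of_notMem_tsupport fun h => hx (hf3 n h)).symm

/-- There is a sequence in `C₀(X)` increasing to one. -/
lemma exists_monotone_tendsto_one (X : Type*) [TopologicalSpace X] [T2Space X]
    [LocallyCompactSpace X] [SecondCountableTopology X] :
    ∃ f : ℕ → C₀(X, ℝ), (∀ n x, f n x ∈ Set.Icc (0 : ℝ) 1) ∧ (∀ x, Monotone fun n => f n x) ∧
      ∀ x, Tendsto (fun n => f n x) atTop (𝓝 1) := by
  obtain ⟨f, hf, hlim⟩ := exists_seq_tendsto_indicator (isOpen_univ (X := X))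
  -- Running maxima make the sequence monotone and, being finite, still vanish at infinity.
  let F : ℕ → C(X, ℝ) := partialSups fun n => (f n).toContinuousMap
  have hF0 : ∀ x, F 0 x = f 0 x := fun x => by simp [F]
  have hF1 : ∀ n x, F (n + 1) x = max (F n x) (f (n + 1) x) := fun n x => by
    simp only [F, partialSups_add_one]
    rfl
  have hle : ∀ n x, F n x ≤ 1 := fun n x => by
    induction n with
    | zero => rw [hF0]; exact (hf 0 x).2
    | succ n ih => rw [hF1]; exact max_le ih (hf _ x).2
  have hge : ∀ n x, f n x ≤ F n x := fun n x => by
    cases n with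
    | zero => rw [hF0]
    | succ n => rw [hF1]; exact le_max_right _ _
  have hz : ∀ n, Tendsto (F n) (cocompact X) (𝓝 0) := fun n => by
    induction n with
    | zero => exact (zero_at_infty (f 0)).congr fun x => (hF0 x).symm
    | succ n ih =>
      have := ih.max (zero_at_infty (f (n + 1)))
      rw [max_self] at this
      exact this.congr fun x => (hF1 n x).symm
  refine ⟨fun n => ⟨F n, hz n⟩, fun n x => ⟨(hf n x).1.trans (hge n x), hle n x⟩,
    fun x => monotone_nat_of_le_succ fun n => ?_, fun x => ?_⟩
  · exact (le_max_left _ _).trans_eq (hF1 n x).symm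
  · have := hlim x
    rw [Set.indicator_of_mem (Set.mem_univ x)] at this
    exact tendsto_of_tendsto_of_tendsto_of_le_of_le this tendsto_const_nhds
      (fun n => hge n x) (fun n => hle n x)

/-- Countably many functions in `C₀(X)` separate the finite Borel measures. -/
lemma exists_countable_separating_measures (X : Type*) [TopologicalSpace X] [T2Space X]
    [LocallyCompactSpace X] [SecondCountableTopology X] [MeasurableSpace X] [BorelSpace X] :
    ∃ g : ℕ → C₀(X, ℂ), ∀ ν ν' : Measure X, IsFiniteMeasure ν → IsFiniteMeasure ν' →
      (∀ n, ∫ x, g n x ∂ν = ∫ x, g n x ∂ν') → ν = ν' := by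
  -- Finite intersections of basic open sets form a countable π-system generating the Borel sets;
  -- the empty intersection supplies `univ`, so that total masses are compared too.
  let b : Set (Set X) :=
    (fun f => ⋂₀ f) '' {f | f.Finite ∧ f ⊆ TopologicalSpace.countableBasis X}
  have hbc : b.Countable := (Set.countable_ofPred_finite_subset
    (TopologicalSpace.countable_countableBasis X)).image _
  have hb : TopologicalSpace.IsTopologicalBasis b :=
    TopologicalSpace.isTopologicalBasis_of_subbasis
      (TopologicalSpace.isBasis_countableBasis X).eq_generateFrom
  have huniv : Set.univ ∈ b := ⟨∅, ⟨Set.finite_empty, Set.empty_subset _⟩, Set.sInter_empty⟩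
  have hpi : IsPiSystem b := by
    rintro _ ⟨s, ⟨hs, hs'⟩, rfl⟩ _ ⟨t, ⟨ht, ht'⟩, rfl⟩ -
    exact ⟨s ∪ t, ⟨hs.union ht, Set.union_subset hs' ht'⟩, Set.sInter_union _ _⟩
  choose f hf hlim using fun U : b => exists_seq_tendsto_indicator (hb.isOpen U.2)
  have : Countable b := hbc.to_subtype
  have : Nonempty b := ⟨⟨_, huniv⟩⟩
  obtain ⟨e, he⟩ := exists_surjective_nat (b × ℕ)
  refine ⟨fun n => complexify (f (e n).1 (e n).2), fun ν ν' hν hν' h => ?_⟩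
  have h' : ∀ U n, ∫ x, f U n x ∂ν = ∫ x, f U n x ∂ν' := fun U n => by
    obtain ⟨k, hk⟩ := he (U, n)
    have := h k
    simp only [hk, complexify_apply] at this
    rw [integral_complex_ofReal, integral_complex_ofReal] at this
    exact_mod_cast this
  have hconv : ∀ (μ : Measure X) [IsFiniteMeasure μ] (U : b),
      Tendsto (fun n => ∫ x, f U n x ∂μ) atTop (𝓝 (μ.real U)) := fun μ _ U => by
    have := tendsto_integral_of_dominated_convergence (μ := μ) (F := fun n x => f U n x)
      (f := (U : Set X).indicator 1) (fun _ => 1)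
      (fun n => (map_continuous (f U n)).measurable.aestronglyMeasurable)
      (integrable_const _)
      (fun n => Eventually.of_forall fun x => by
        rw [Real.norm_of_nonneg (hf U n x).1]; exact (hf U n x).2)
      (Eventually.of_forall fun x => hlim U x)
    rwa [integral_indicator_one (hb.isOpen U.2).measurableSet] at this
  have heq : ∀ U ∈ b, ν U = ν' U := fun U hU => by
    have := tendsto_nhds_unique (hconv ν ⟨U, hU⟩)
      ((hconv ν' ⟨U, hU⟩).congr fun n => (h' _ n).symm)
    exact (measureReal_eq_measureReal_iff).1 this
  exact ext_of_generate_finite b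
    ((BorelSpace.measurable_eq (α := X)).trans hb.borel_eq_generateFrom) hpi heq (heq _ huniv)

end Separation

lemma MeasureTheory.hasSum_real_iUnion {X : Type*} [MeasurableSpace X] (m : Measure X)
    [IsFiniteMeasure m] {A : ℕ → Set X} (hA : ∀ i, MeasurableSet (A i))
    (hd : Pairwise (Function.onFun Disjoint A)) :
    HasSum (fun i => m.real (A i)) (m.real (⋃ i, A i)) := by
  have h : ∑' i, m (A i) ≠ ∞ := by
    rw [← measure_iUnion hd hA]
    exact measure_ne_top _ _
  have := ENNReal.hasSum_toReal h
  rwa [← ENNReal.tsum_toReal_eq (fun i => measure_ne_top _ _), ← measure_iUnion hd hA] at this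

section Positive

variable {H : Type*} [NormedAddCommGroup H] [InnerProductSpace ℂ H]

lemma ContinuousLinearMap.isPositive_of_inner_self_nonneg {T : H →L[ℂ] H}
    (h : ∀ ψ, 0 ≤ inner ℂ ψ (T ψ)) : T.IsPositive := by
  refine (ContinuousLinearMap.isPositive_iff_complex T).2 fun ψ => ?_
  obtain ⟨h1, h2⟩ := Complex.le_def.1 (h ψ)
  rw [← inner_conj_symm (T ψ) ψ]
  refine ⟨Complex.ext rfl ?_, h1⟩
  rw [Complex.conj_im, ← h2]
  simp

end Positive

/-! ### Scalar measures of a representation of `C(X)` -/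

section StarAlgHom

variable {X H : Type*} [TopologicalSpace X] [NormedAddCommGroup H]
  [InnerProductSpace ℂ H] [CompleteSpace H]

/-- A non-negative `g` equals `s* s` with `s = √g`, so the form is `‖π(s)ψ‖²`. -/
lemma inner_starAlgHom_nonneg (π : C(X, ℂ) →⋆ₐ[ℂ] (H →L[ℂ] H)) {g : C(X, ℂ)}
    (hg : ∀ x, 0 ≤ g x) (ψ : H) : 0 ≤ inner ℂ ψ (π g ψ) := by
  let s : C(X, ℂ) := ⟨fun x => (Real.sqrt (g x).re : ℂ), by fun_prop⟩
  have hs : g = star s * s := by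
    ext x
    obtain ⟨h1, h2⟩ := Complex.le_def.1 (hg x)
    simp only [ContinuousMap.mul_apply, ContinuousMap.star_apply, s, ContinuousMap.coe_mk,
      Complex.star_def, Complex.conj_ofReal, ← Complex.ofReal_mul]
    rw [Real.mul_self_sqrt h1]
    exact Complex.ext (by simp) (by simpa using h2.symm)
  rw [hs, map_mul, map_star, mul_apply_eq_comp,
    ContinuousLinearMap.star_eq_adjoint,
    ContinuousLinearMap.adjoint_inner_right]
  rw [inner_self_eq_norm_sq_to_K]
  have h := Complex.zero_le_real.2 (sq_nonneg ‖π s ψ‖)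
  rwa [Complex.ofReal_pow] at h

variable [CompactSpace X] [T2Space X] [MeasurableSpace X] [BorelSpace X]

lemma exists_measure_inner_starAlgHom (π : C(X, ℂ) →⋆ₐ[ℂ] (H →L[ℂ] H)) (ψ : H) :
    ∃ m : Measure X, IsFiniteMeasure m ∧
      ∀ g : C(X, ℂ), inner ℂ ψ (π g ψ) = ∫ x, g x ∂m := by
  let Λ : C₀(X, ℂ) →ₗ[ℂ] ℂ :=
    { toFun := fun f => inner ℂ ψ (π f.toContinuousMap ψ)
      map_add' := fun f g => by
        rw [show (f + g).toContinuousMap = f.toContinuousMap + g.toContinuousMap from rfl,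
          map_add, add_apply, inner_add_right]
      map_smul' := fun c f => by
        rw [show (c • f).toContinuousMap = c • f.toContinuousMap from rfl,
          map_smul, smul_apply, inner_smul_right]
        rfl }
  obtain ⟨m, hm, hm'⟩ := exists_measure_of_positive Λ (‖ψ‖ * ‖ψ‖)
    (fun f hf => inner_starAlgHom_nonneg π hf ψ) (fun f hf hf' => by
      refine (norm_inner_le_norm _ _).trans (mul_le_mul_of_nonneg_left ?_ (norm_nonneg _))
      refine (ContinuousLinearMap.le_opNorm _ _).trans (mul_le_of_le_one_left (norm_nonneg _) ?_)
      refine (NonUnitalStarAlgHom.norm_apply_le π _).trans ?_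
      refine (ContinuousMap.norm_le _ zero_le_one).2 fun x => ?_
      have h1 := hf x
      have h2 := hf' x
      change ‖f x‖ ≤ 1
      have h3 := Complex.eq_re_of_ofReal_le (r := 0) (by simpa using h1)
      rw [h3, Complex.norm_real, Real.norm_of_nonneg (by simpa using (Complex.le_def.1 h1).1)]
      simpa using (Complex.le_def.1 h2).1)
  exact ⟨m, ⟨hm.trans_lt ENNReal.ofReal_lt_top⟩,
    fun g => hm' (ZeroAtInftyContinuousMap.ContinuousMap.liftZeroAtInfty g)⟩

end StarAlgHom

/-! ### The spectral theorem for representations of `C(X)` -/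

section Construction

variable {X : Type*} [TopologicalSpace X] [TopologicalSpace.MetrizableSpace X]

/-- Continuous functions decreasing to the indicator of a closed set. -/
def closedApprox {K : Set X} (hK : IsClosed K) (n : ℕ) : C(X, ℂ) :=
  ⟨fun x => ((hK.apprSeq n x : ℝ) : ℂ), by fun_prop⟩

lemma norm_closedApprox_le {K : Set X} (hK : IsClosed K) (n : ℕ) (x : X) :
    ‖closedApprox hK n x‖ ≤ 1 := by
  simp only [closedApprox, ContinuousMap.coe_mk, Complex.norm_real, NNReal.norm_eq]
  exact_mod_cast HasOuterApproxClosed.apprSeq_apply_le_one hK n x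

lemma tendsto_closedApprox {K : Set X} (hK : IsClosed K) (x : X) :
    Tendsto (fun n => closedApprox hK n x) atTop (𝓝 (K.indicator 1 x)) := by
  have h := (tendsto_pi_nhds.1 (HasOuterApproxClosed.tendsto_apprSeq hK)) x
  have h' := (Complex.continuous_ofReal.tendsto _).comp ((NNReal.continuous_coe.tendsto _).comp h)
  convert! h' using 2
  by_cases hx : x ∈ K <;> simp [hx]

variable [MeasurableSpace X] [BorelSpace X]

lemma tendsto_integral_closedApprox_mul {K : Set X} (hK : IsClosed K) (m : Measure X)
    [IsFiniteMeasure m] {g : X → ℂ} (hg : Integrable g m) :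
    Tendsto (fun n => ∫ x, closedApprox hK n x * g x ∂m) atTop (𝓝 (∫ x in K, g x ∂m)) := by
  rw [← integral_indicator hK.measurableSet]
  refine tendsto_integral_of_dominated_convergence (fun x => ‖g x‖)
    (fun n => (closedApprox hK n).continuous.measurable.aestronglyMeasurable.mul hg.1) hg.norm
    (fun n => Eventually.of_forall fun x => ?_) (Eventually.of_forall fun x => ?_)
  · rw [norm_mul]
    exact mul_le_of_le_one_left (norm_nonneg _) (norm_closedApprox_le hK n x)
  · have := (tendsto_closedApprox hK x).mul_const (g x)
    convert this using 2
    by_cases hx : x ∈ K <;> simp [hx]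

variable {H : Type*} [CompactSpace X] [NormedAddCommGroup H] [InnerProductSpace ℂ H]
  [CompleteSpace H]

/-- Every unital `*`-representation of `C(X)` is the integral of a projection valued measure. -/
theorem exists_PVM_of_starAlgHom (π : C(X, ℂ) →⋆ₐ[ℂ] (H →L[ℂ] H)) :
    ∃ P : PVM X H, ∀ g : C(X, ℂ), P.IsIntegral g (π g) := by
  choose m hfin hm using exists_measure_inner_starAlgHom π
  have huniv : ∀ ψ, ((m ψ).real Set.univ : ℂ) = inner ℂ ψ ψ := fun ψ => by
    have := hm ψ 1
    rw [map_one] at this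
    simpa using this.symm
  have hle : ∀ ψ A, (m ψ).real A ≤ 1 * ‖ψ‖ ^ 2 := fun ψ A => by
    rw [one_mul]
    refine (measureReal_mono (Set.subset_univ A)).trans (le_of_eq ?_)
    have := huniv ψ
    rw [inner_self_eq_norm_sq_to_K] at this
    exact Complex.ofReal_injective (by simpa using this)
  have hnorm : ∀ ψ A, ‖((m ψ).real A : ℂ)‖ ≤ 1 * ‖ψ‖ ^ 2 := fun ψ A => by
    rw [Complex.norm_real, Real.norm_of_nonneg measureReal_nonneg]
    exact hle ψ A
  have hInt : ∀ ψ (g : C(X, ℂ)), Integrable g (m ψ) := fun ψ g =>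
    Integrable.of_bound g.continuous.measurable.aestronglyMeasurable ‖g‖
      (Eventually.of_forall fun x => g.norm_coe_le_norm x)
  have hclosed : ∀ K (hK : IsClosed K) ψ, Tendsto
      (fun n => inner ℂ ψ (π (closedApprox hK n) ψ)) atTop (𝓝 ((m ψ).real K : ℂ)) := by
    intro K hK ψ
    have := tendsto_integral_closedApprox_mul hK (m ψ) (hInt ψ 1)
    simpa [hm] using this
  -- π-λ induction from closed sets, where the operator is a weak limit of `π (closedApprox hK n)`;
  -- disjoint unions use weak limits of partial sums.
  have hex : ∀ A, MeasurableSet A → ∃ T : H →L[ℂ] H, ∀ ψ,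
      inner ℂ ψ (T ψ) = ((m ψ).real A : ℂ) := by
    refine MeasurableSpace.induction_on_inter
      ((BorelSpace.measurable_eq (α := X)).trans borel_eq_generateFrom_isClosed)
      isPiSystem_isClosed ⟨0, by simp⟩ ?_ ?_ ?_
    · intro K hK
      refine exists_inner_self_eq_of_tendsto (C := 1) (fun n ψ => ?_) (hclosed K hK)
      rw [hm]
      refine (norm_integral_le_of_norm_le_const
        (Eventually.of_forall (norm_closedApprox_le hK n))).trans ?_
      rw [one_mul]
      exact hle ψ _
    · rintro A hA ⟨T, hT⟩
      refine ⟨1 - T, fun ψ => ?_⟩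
      rw [sub_apply, inner_sub_right, hT, one_apply_eq_self,
        ← huniv, measureReal_compl hA, Complex.ofReal_sub]
    · intro A hd hA hT
      choose T hT using hT
      have hsum : ∀ n ψ, inner ℂ ψ ((∑ i ∈ Finset.range n, T i) ψ)
          = ((m ψ).real (⋃ i ∈ Finset.range n, A i) : ℂ) := fun n ψ => by
        rw [measureReal_biUnion_finset (fun i _ j _ hij => hd hij) (fun i _ => hA i),
          sum_apply, inner_sum, Complex.ofReal_sum]
        exact Finset.sum_congr rfl fun i _ => hT i ψ
      refine exists_inner_self_eq_of_tendsto (C := 1)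
        (T := fun n => ∑ i ∈ Finset.range n, T i) (fun n ψ => ?_) (fun ψ => ?_)
      · rw [hsum]
        exact hnorm ψ _
      · have := ((Complex.hasSum_ofReal.2
          (hasSum_real_iUnion (m ψ) hA hd)).tendsto_sum_nat)
        refine this.congr fun n => ?_
        rw [sum_apply, inner_sum]
        exact Finset.sum_congr rfl fun i _ => (hT i ψ).symm
  choose! T hT using hex
  have hadj : ∀ A, MeasurableSet A → ∀ x y, inner ℂ (T A x) y = inner ℂ x (T A y) := by
    intro A hA x y
    have hpos := ContinuousLinearMap.isPositive_of_inner_self_nonneg (T := T A) fun ψ => by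
      rw [hT A hA]
      exact Complex.zero_le_real.2 measureReal_nonneg
    exact hpos.isSymmetric x y
  have hsigma : ∀ A : ℕ → Set X, (∀ i, MeasurableSet (A i)) →
      Pairwise (fun i j => Disjoint (A i) (A j)) →
      ∀ u v : H, HasSum (fun i => inner ℂ u (T (A i) v)) (inner ℂ u (T (⋃ i, A i) v)) := by
    intro A hA hd u v
    have h := tendsto_inner_of_tendsto_inner_self (l := atTop)
      (T := fun s : Finset ℕ => ∑ i ∈ s, T (A i)) (T' := T (⋃ i, A i)) (fun ψ => ?_) u v
    · refine h.congr fun s => ?_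
      rw [sum_apply, inner_sum]
    · rw [hT _ (MeasurableSet.iUnion hA)]
      refine (Complex.hasSum_ofReal.2 (hasSum_real_iUnion (m ψ) hA hd)).congr fun s => ?_
      rw [sum_apply, inner_sum]
      exact Finset.sum_congr rfl fun i _ => (hT _ (hA i) ψ).symm
  have hcompl : ∀ A, MeasurableSet A → T Aᶜ = 1 - T A := fun A hA => by
    refine ContinuousLinearMap.ext_inner_self fun ψ => ?_
    rw [hT _ hA.compl, sub_apply, inner_sub_right, hT _ hA,
      one_apply_eq_self, ← huniv, measureReal_compl hA, Complex.ofReal_sub]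
  have hempty : T ∅ = 0 := by
    refine ContinuousLinearMap.ext_inner_self fun ψ => ?_
    rw [hT _ MeasurableSet.empty]
    simp
  have hdiff : ∀ A B, MeasurableSet A → MeasurableSet B → T (A ∩ Bᶜ) = T A - T (A ∩ B) := by
    intro A B hA hB
    refine ContinuousLinearMap.ext_inner_self fun ψ => ?_
    rw [hT _ (hA.inter hB.compl), sub_apply, inner_sub_right, hT _ hA,
      hT _ (hA.inter hB), ← Complex.ofReal_sub,
      ← measureReal_inter_add_sdiff (s := A) hB, add_sub_cancel_left, Set.sdiff_eq]
  have hclcl : ∀ K L, IsClosed K → IsClosed L → T K * T L = T (K ∩ L) := by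
    intro K L hK hL
    have hKw := tendsto_inner_of_tendsto_inner_self (T := fun n => π (closedApprox hK n))
      (T' := T K) (l := atTop) fun ψ => by rw [hT K hK.measurableSet]; exact hclosed K hK ψ
    have hLw := tendsto_inner_of_tendsto_inner_self (T := fun n => π (closedApprox hL n))
      (T' := T L) (l := atTop) fun ψ => by rw [hT L hL.measurableSet]; exact hclosed L hL ψ
    refine ContinuousLinearMap.ext_inner_self fun ψ => ?_
    rw [hT _ (hK.inter hL).measurableSet]
    -- Only one factor passes to the limit at a time, since multiplication is not jointly weakly
    -- continuous. Here `L` is approximated and `π g` is moved to the left by its adjoint.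
    have hfix : ∀ g : C(X, ℂ), inner ℂ ψ (π g (T L ψ)) = ∫ x in L, g x ∂(m ψ) := fun g => by
      have h1 := hLw (ContinuousLinearMap.adjoint (π g) ψ) ψ
      simp only [ContinuousLinearMap.adjoint_inner_left] at h1
      refine tendsto_nhds_unique h1
        ((tendsto_integral_closedApprox_mul hL (m ψ) (hInt ψ g)).congr fun n => ?_)
      rw [← mul_apply_eq_comp, ← map_mul, hm]
      simp [mul_comm]
    have h2 := hKw ψ (T L ψ)
    refine tendsto_nhds_unique h2 ?_
    have h3 := tendsto_integral_closedApprox_mul hK ((m ψ).restrict L) (g := 1)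
      (integrable_const _)
    simp only [hfix]
    simpa [Measure.restrict_restrict hK.measurableSet, measureReal_def,
      Measure.restrict_apply hK.measurableSet] using h3
  have hstar : ∀ A, MeasurableSet A → star (T A) = T A := fun A hA => by
    rw [ContinuousLinearMap.star_eq_adjoint]
    exact ((ContinuousLinearMap.eq_adjoint_iff _ _).2 (hadj A hA)).symm
  -- With the left factor fixed, the admissible right factors form a λ-system, so closed sets
  -- suffice.
  have hind : ∀ B, MeasurableSet B → (∀ K, IsClosed K → T B * T K = T (B ∩ K)) →
      ∀ A, MeasurableSet A → T B * T A = T (B ∩ A) := by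
    intro B hB hBK
    refine MeasurableSpace.induction_on_inter
      ((BorelSpace.measurable_eq (α := X)).trans borel_eq_generateFrom_isClosed)
      isPiSystem_isClosed ?_ hBK ?_ ?_
    · rw [Set.inter_empty, hempty, mul_zero]
    · intro A hA ih
      rw [hcompl A hA, mul_sub, mul_one, ih, hdiff B A hB hA]
    · intro A hd hA ih
      ext v
      refine ext_inner_left ℂ fun u => ?_
      rw [mul_apply_eq_comp, ← hadj B hB, Set.inter_iUnion]
      refine (hsigma A hA hd _ v).unique ?_
      refine (hsigma (fun i => B ∩ A i) (fun i => hB.inter (hA i))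
        (fun i j hij => (hd hij).mono Set.inter_subset_right Set.inter_subset_right) u v).congr
        fun s => Finset.sum_congr rfl fun i _ => ?_
      change inner ℂ u (T (B ∩ A i) v) = inner ℂ (T B u) (T (A i) v)
      rw [← ih i, hadj B hB, mul_apply_eq_comp]
  have hmul : ∀ A B, MeasurableSet A → MeasurableSet B → T A * T B = T (A ∩ B) := by
    intro A B hA hB
    refine hind A hA (fun K hK => ?_) B hB
    -- With a closed left factor, any Borel right factor is allowed; taking adjoints swaps the two
    -- and supplies the hypothesis for a Borel left factor.
    have := hind K hK.measurableSet (fun L hL => hclcl K L hK hL) A hA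
    have h2 := congrArg star this
    rwa [star_mul, hstar A hA, hstar K hK.measurableSet, hstar _ (hK.measurableSet.inter hA),
      Set.inter_comm] at h2
  let P : PVM X H :=
    { toFun := T
      isPositive := fun A hA => ContinuousLinearMap.isPositive_of_inner_self_nonneg fun ψ => by
        rw [hT A hA]
        exact Complex.zero_le_real.2 measureReal_nonneg
      univ := ContinuousLinearMap.ext_inner_self fun ψ => by
        rw [hT _ MeasurableSet.univ, huniv, one_apply_eq_self]
      hasSum_iUnion := hsigma
      mul_eq := hmul }
  refine ⟨P, fun g ψ => ?_⟩
  have hvec : P.vecMeasure ψ = m ψ := by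
    ext A hA
    rw [POVM.vecMeasure, Measure.ofMeasurable_apply A hA]
    change ENNReal.ofReal (inner ℂ ψ (T A ψ)).re = _
    rw [hT A hA, Complex.ofReal_re, ofReal_measureReal]
  rw [hvec, hm]

end Construction

/-! ### Multiplicativity of integration against a PVM -/

section Integral

variable {X H : Type*} [MeasurableSpace X] [NormedAddCommGroup H]
  [InnerProductSpace ℂ H] [CompleteSpace H]

namespace POVM

lemma vecMeasure_apply (P : POVM X H) (ψ : H) {A : Set X} (hA : MeasurableSet A) :
    P.vecMeasure ψ A = ENNReal.ofReal (inner ℂ ψ (P.toFun A ψ)).re := by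
  rw [POVM.vecMeasure, Measure.ofMeasurable_apply A hA]

instance isFiniteMeasure_vecMeasure (P : POVM X H) (ψ : H) : IsFiniteMeasure (P.vecMeasure ψ) :=
  ⟨by rw [P.vecMeasure_apply ψ MeasurableSet.univ]; exact ENNReal.ofReal_lt_top⟩

lemma vecMeasure_real (P : POVM X H) (ψ : H) {A : Set X} (hA : MeasurableSet A) :
    ((P.vecMeasure ψ).real A : ℂ) = inner ℂ ψ (P.toFun A ψ) := by
  have h := (P.isPositive A hA).inner_nonneg_right ψ
  obtain ⟨h1, h2⟩ := Complex.le_def.1 h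
  rw [measureReal_def, P.vecMeasure_apply ψ hA, ENNReal.toReal_ofReal h1]
  exact Complex.ext rfl h2

lemma inner_toFun_left (P : POVM X H) {A : Set X} (hA : MeasurableSet A) (x y : H) :
    inner ℂ (P.toFun A x) y = inner ℂ x (P.toFun A y) :=
  (P.isPositive A hA).isSymmetric x y

namespace IsIntegral

variable {P : POVM X H} {φ φ' : X → ℂ} {T T' : H →L[ℂ] H}

lemma unique (h : P.IsIntegral φ T) (h' : P.IsIntegral φ T') : T = T' :=
  ContinuousLinearMap.ext_inner_self fun ψ => (h ψ).trans (h' ψ).symm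

lemma star (h : P.IsIntegral φ T) :
    P.IsIntegral (fun x => starRingEnd ℂ (φ x)) (star T) := fun ψ => by
  rw [ContinuousLinearMap.star_eq_adjoint, ContinuousLinearMap.adjoint_inner_right,
    ← inner_conj_symm, h ψ, integral_conj]

lemma add (h : P.IsIntegral φ T) (h' : P.IsIntegral φ' T')
    (hφ : ∀ ψ, Integrable φ (P.vecMeasure ψ)) (hφ' : ∀ ψ, Integrable φ' (P.vecMeasure ψ)) :
    P.IsIntegral (fun x => φ x + φ' x) (T + T') := fun ψ => by
  rw [add_apply, inner_add_right, h ψ, h' ψ, integral_add (hφ ψ) (hφ' ψ)]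

lemma const_mul (h : P.IsIntegral φ T) (c : ℂ) :
    P.IsIntegral (fun x => c * φ x) (c • T) := fun ψ => by
  rw [smul_apply, inner_smul_right, h ψ, integral_const_mul]

end IsIntegral

lemma isIntegral_const (P : POVM X H) (c : ℂ) : P.IsIntegral (fun _ => c) (c • 1) := fun ψ => by
  rw [integral_const, Complex.real_smul, P.vecMeasure_real ψ MeasurableSet.univ, P.univ,
    smul_apply, inner_smul_right, mul_comm]

end POVM

namespace PVM

variable (P : PVM X H)

lemma toFun_mul_self {A : Set X} (hA : MeasurableSet A) :
    P.toFun A * P.toFun A = P.toFun A := by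
  rw [P.mul_eq A A hA hA, Set.inter_self]

lemma toFun_mul_comm {A B : Set X} (hA : MeasurableSet A) (hB : MeasurableSet B) :
    P.toFun A * P.toFun B = P.toFun B * P.toFun A := by
  rw [P.mul_eq A B hA hB, P.mul_eq B A hB hA, Set.inter_comm]

/-- Since `P(A)P(B)P(A) = P(B ∩ A)`, projecting the vector restricts its measure. This links
multiplication by `P(A)` with integration over `A`. -/
lemma vecMeasure_toFun {A : Set X} (hA : MeasurableSet A) (ψ : H) :
    P.vecMeasure (P.toFun A ψ) = (P.vecMeasure ψ).restrict A := by
  ext B hB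
  rw [Measure.restrict_apply hB, P.vecMeasure_apply _ hB, P.vecMeasure_apply _ (hB.inter hA),
    P.inner_toFun_left hA, ← mul_apply_eq_comp, ← mul_apply_eq_comp, mul_assoc,
    P.mul_eq B A hB hA, P.mul_eq A _ hA (hB.inter hA), Set.inter_left_comm, Set.inter_self]

end PVM

namespace POVM.IsIntegral

variable {P : PVM X H} {φ φ' : X → ℂ} {T T' : H →L[ℂ] H}

/-- The integral commutes with the projections. -/
lemma commute_toFun (h : P.IsIntegral φ T) {A : Set X} (hA : MeasurableSet A) :
    P.toFun A * T = T * P.toFun A := by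
  -- The reflection `U` is a self-adjoint involution commuting with every `P(B)`, so it preserves
  -- all vector measures. Hence `U T U` and `T` have the same quadratic form, and `T` commutes with
  -- `U`.
  set U : H →L[ℂ] H := (2 : ℂ) • P.toFun A - 1 with hU
  have hUU : U * U = 1 := by
    rw [hU, sub_mul, mul_sub, smul_mul_smul_comm, P.toFun_mul_self hA]
    simp only [mul_one, one_mul]
    module
  have hUadj : ∀ x y, inner ℂ (U x) y = inner ℂ x (U y) := fun x y => by
    simp only [hU, sub_apply, smul_apply, one_apply_eq_self, inner_sub_left, inner_sub_right,
      inner_smul_left, inner_smul_right, P.inner_toFun_left hA, Complex.conj_ofNat]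
  have hUvec : ∀ ψ, P.vecMeasure (U ψ) = P.vecMeasure ψ := fun ψ => by
    ext B hB
    have hc : P.toFun B * U = U * P.toFun B := by
      rw [hU, mul_sub, sub_mul, mul_one, one_mul, mul_smul_comm, smul_mul_assoc,
        P.toFun_mul_comm hA hB]
    rw [P.vecMeasure_apply _ hB, P.vecMeasure_apply _ hB, hUadj, ← mul_apply_eq_comp,
      ← mul_apply_eq_comp, mul_assoc, hc, ← mul_assoc, hUU, one_mul]
  have hUTU : U * T * U = T := ContinuousLinearMap.ext_inner_self fun ψ => by
    rw [mul_apply_eq_comp, mul_apply_eq_comp, ← hUadj, h, h, hUvec]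
  have hUT : U * T = T * U := by
    rw [← mul_one (U * T), ← hUU, ← mul_assoc, hUTU]
  rw [hU, sub_mul, mul_sub, mul_one, one_mul, mul_smul_comm, smul_mul_assoc, sub_left_inj] at hUT
  exact smul_right_injective _ two_ne_zero hUT

lemma indicator_mul (h : P.IsIntegral φ T) {A : Set X} (hA : MeasurableSet A) :
    P.IsIntegral (A.indicator φ) (P.toFun A * T) := fun ψ => by
  -- `P(A)T = P(A)TP(A)`, whose quadratic form at `ψ` is that of `T` at `P(A)ψ`.
  rw [← P.toFun_mul_self hA, mul_assoc, h.commute_toFun hA, mul_apply_eq_comp,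
    mul_apply_eq_comp, ← P.inner_toFun_left hA, h, P.vecMeasure_toFun hA,
    integral_indicator hA]

lemma exists_simpleFunc (s : SimpleFunc X ℂ) :
    ∃ S : H →L[ℂ] H, P.IsIntegral s S ∧ ∀ (φ : X → ℂ) (T : H →L[ℂ] H),
      (∀ ψ, Integrable φ (P.vecMeasure ψ)) → P.IsIntegral φ T →
      P.IsIntegral (fun x => s x * φ x) (S * T) := by
  have hprod : ∀ (s : SimpleFunc X ℂ) (φ : X → ℂ), (∀ ψ, Integrable φ (P.vecMeasure ψ)) →
      ∀ ψ, Integrable (fun x => s x * φ x) (P.vecMeasure ψ) := fun s φ hφ ψ => by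
    obtain ⟨C, hC⟩ := s.exists_forall_norm_le
    exact (hφ ψ).bdd_mul s.measurable.aestronglyMeasurable (Eventually.of_forall hC)
  induction s using SimpleFunc.induction with
  | const c hs =>
    rename_i A
    have key : ∀ (φ : X → ℂ) (T : H →L[ℂ] H), P.IsIntegral φ T → P.IsIntegral
        (fun x => SimpleFunc.piecewise A hs (SimpleFunc.const X c) (SimpleFunc.const X 0) x * φ x)
        (c • P.toFun A * T) := fun φ T h => by
      have := (h.indicator_mul hs).const_mul c
      rw [smul_mul_assoc]
      convert this using 2 with x
      by_cases hx : x ∈ A <;> simp [hx]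
    refine ⟨c • P.toFun A, ?_, fun φ T _ h => key φ T h⟩
    have := key _ _ (P.isIntegral_const 1)
    simpa using this
  | add hd hf hg =>
    rename_i f g
    obtain ⟨S, hS, hS'⟩ := hf
    obtain ⟨R, hR, hR'⟩ := hg
    refine ⟨S + R, hS.add hR (fun ψ => f.integrable_of_isFiniteMeasure)
      (fun ψ => g.integrable_of_isFiniteMeasure), fun φ T hφ h => ?_⟩
    have := (hS' φ T hφ h).add (hR' φ T hφ h) (hprod f φ hφ) (hprod g φ hφ)
    rw [add_mul]
    convert this using 2 with x
    simp [add_mul]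

/-- The integral with respect to a projection valued measure is multiplicative. -/
theorem mul (h : P.IsIntegral φ T) (h' : P.IsIntegral φ' T') {C : ℝ} (hφ : Measurable φ)
    (hC : ∀ x, ‖φ x‖ ≤ C) (hφ' : ∀ ψ, Integrable φ' (P.vecMeasure ψ)) :
    P.IsIntegral (fun x => φ x * φ' x) (T * T') := by
  have hC' : ∀ x, ‖φ x‖ ≤ max C 0 := fun x => (hC x).trans (le_max_left _ _)
  have hC0 : 0 ≤ max C 0 := le_max_right _ _
  have hsm := hφ.stronglyMeasurable
  let s := hsm.approxBounded (max C 0)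
  have hs : ∀ x, Tendsto (fun n => s n x) atTop (𝓝 (φ x)) := fun x =>
    hsm.tendsto_approxBounded_of_norm_le (hC' x)
  have hsn : ∀ n x, ‖s n x‖ ≤ max C 0 := fun n x => hsm.norm_approxBounded_le hC0 n x
  choose S hS hS' using fun n => exists_simpleFunc (P := P) (s n)
  -- Weak convergence of the simple-function integrals is enough, because the other factor `T'`
  -- stays fixed.
  have hw := tendsto_inner_of_tendsto_inner_self (T := S) (T' := T) (l := atTop) fun ψ => by
    rw [h ψ]
    simp only [hS _ ψ]
    exact tendsto_integral_of_dominated_convergence (fun _ => max C 0)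
      (fun n => (s n).measurable.aestronglyMeasurable) (integrable_const _)
      (fun n => Eventually.of_forall (hsn n)) (Eventually.of_forall hs)
  intro ψ
  refine tendsto_nhds_unique (hw ψ (T' ψ)) ?_
  have : ∀ n, inner ℂ ψ (S n (T' ψ)) = ∫ x, s n x * φ' x ∂(P.vecMeasure ψ) := fun n =>
    hS' n φ' T' hφ' h' ψ
  simp only [this]
  refine tendsto_integral_of_dominated_convergence (fun x => max C 0 * ‖φ' x‖)
    (fun n => (s n).measurable.aestronglyMeasurable.mul (hφ' ψ).1) ((hφ' ψ).norm.const_mul _)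
    (fun n => Eventually.of_forall fun x => ?_)
    (Eventually.of_forall fun x => (hs x).mul_const _)
  rw [norm_mul]
  exact mul_le_mul_of_nonneg_right (hsn n x) (norm_nonneg _)

end POVM.IsIntegral

end Integral

/-! ### The weak* topology on measures of mass at most one -/

namespace PosBall

variable {Ω : Type*} [MeasurableSpace Ω]

instance isFiniteMeasure (ν : PosBall Ω) : IsFiniteMeasure ν.1 :=
  ⟨ν.2.trans_lt ENNReal.one_lt_top⟩

variable [TopologicalSpace Ω]

lemma continuous_iff {Y : Type*} [TopologicalSpace Y] {μ : Y → PosBall Ω} :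
    Continuous μ ↔ ∀ f : C₀(Ω, ℂ), Continuous fun y => (μ y).pairing f := by
  rw [continuous_induced_rng, continuous_pi_iff]
  rfl

lemma continuous_pairing (f : C₀(Ω, ℂ)) : Continuous fun ν : PosBall Ω => ν.pairing f :=
  continuous_iff.1 continuous_id f

variable [T2Space Ω] [LocallyCompactSpace Ω] [SecondCountableTopology Ω] [BorelSpace Ω]

lemma exists_countable_separating (Ω : Type*) [TopologicalSpace Ω] [T2Space Ω]
    [LocallyCompactSpace Ω] [SecondCountableTopology Ω] [MeasurableSpace Ω] [BorelSpace Ω] :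
    ∃ g : ℕ → C₀(Ω, ℂ), ∀ ν ν' : PosBall Ω, (∀ n, ν.pairing (g n) = ν'.pairing (g n)) → ν = ν' := by
  obtain ⟨g, hg⟩ := exists_countable_separating_measures Ω
  exact ⟨g, fun ν ν' h => Subtype.ext (hg ν.1 ν'.1 inferInstance inferInstance h)⟩

lemma ext_pairing {ν ν' : PosBall Ω} (h : ∀ f, ν.pairing f = ν'.pairing f) : ν = ν' := by
  obtain ⟨g, hg⟩ := exists_countable_separating Ω
  exact hg ν ν' fun n => h _

instance t2Space : T2Space (PosBall Ω) :=
  T2Space.of_injective_continuous (f := fun (ν : PosBall Ω) (f : C₀(Ω, ℂ)) => ν.pairing f)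
    (fun _ _ h => ext_pairing fun f => congrFun h f) continuous_induced_dom

/-- Countably many continuous pairings separate points, so they embed a compact set in a countable
product of metric spaces. -/
lemma metrizableSpace_of_isCompact {K : Set (PosBall Ω)} (hK : IsCompact K) :
    TopologicalSpace.MetrizableSpace K := by
  have : CompactSpace K := isCompact_iff_compactSpace.1 hK
  obtain ⟨g, hg⟩ := exists_countable_separating Ω
  refine Metric.PiNatEmbed.TopologicalSpace.MetrizableSpace.of_countable_separating
    (fun n (ν : K) => ν.1.pairing (g n))
    (fun n => (continuous_pairing (g n)).comp continuous_subtype_val) fun x y hxy => ?_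
  by_contra! h
  exact hxy (Subtype.ext (hg _ _ h))

end PosBall

/-! ### Uniqueness of the representation -/

section Uniqueness

lemma ContinuousMap.integrable_comp {X Y : Type*} [TopologicalSpace X] [CompactSpace X]
    [TopologicalSpace Y] [MeasurableSpace Y] [OpensMeasurableSpace Y] (g : C(X, ℂ)) {a : Y → X}
    (ha : Continuous a) (m : Measure Y) [IsFiniteMeasure m] : Integrable (fun y => g (a y)) m :=
  Integrable.of_bound (g.continuous.comp ha).measurable.aestronglyMeasurable ‖g‖
    (Eventually.of_forall fun y => g.norm_coe_le_norm (a y))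

/-- The integral is Lipschitz in `g` with the total mass as constant; this lets equality of
integrals pass to uniform closures. -/
lemma ContinuousMap.continuous_integral_comp {X Y : Type*} [TopologicalSpace X] [CompactSpace X]
    [TopologicalSpace Y] [MeasurableSpace Y] [OpensMeasurableSpace Y] {a : Y → X}
    (ha : Continuous a) (m : Measure Y) [IsFiniteMeasure m] :
    Continuous fun g : C(X, ℂ) => ∫ y, g (a y) ∂m := by
  refine (LipschitzWith.of_dist_le_mul (K := (m.real Set.univ).toNNReal) fun f g => ?_).continuous
  rw [dist_eq_norm, ← integral_sub (f.integrable_comp ha m) (g.integrable_comp ha m),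
    Real.coe_toNNReal _ measureReal_nonneg, mul_comm, dist_eq_norm]
  exact norm_integral_le_of_norm_le_const
    (Eventually.of_forall fun y => (f - g).norm_coe_le_norm (a y))

variable {S S' X H : Type*} [TopologicalSpace X] [CompactSpace X]
  [TopologicalSpace S] [MeasurableSpace S] [OpensMeasurableSpace S]
  [TopologicalSpace S'] [MeasurableSpace S'] [OpensMeasurableSpace S']
  [NormedAddCommGroup H] [InnerProductSpace ℂ H] [CompleteSpace H]

/-- The continuous functions on `X` which have the same integrals with respect to the images of
two projection valued measures. -/
def PVM.equalIntegrals (P : PVM S H) (P' : PVM S' H) (a : C(S, X)) (b : C(S', X)) :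
    StarSubalgebra ℂ C(X, ℂ) where
  carrier := {g | ∃ T, P.IsIntegral (fun s => g (a s)) T ∧ P'.IsIntegral (fun s => g (b s)) T}
  -- Closure under products is where both measures must be projection valued.
  mul_mem' := by
    rintro f g ⟨T, hT, hT'⟩ ⟨R, hR, hR'⟩
    exact ⟨T * R,
      hT.mul hR (f.continuous.comp a.continuous).measurable (fun x => f.norm_coe_le_norm _)
        (fun ψ => g.integrable_comp a.continuous _),
      hT'.mul hR' (f.continuous.comp b.continuous).measurable (fun x => f.norm_coe_le_norm _)
        (fun ψ => g.integrable_comp b.continuous _)⟩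
  add_mem' := by
    rintro f g ⟨T, hT, hT'⟩ ⟨R, hR, hR'⟩
    exact ⟨T + R,
      hT.add hR (fun ψ => f.integrable_comp a.continuous _)
        (fun ψ => g.integrable_comp a.continuous _),
      hT'.add hR' (fun ψ => f.integrable_comp b.continuous _)
        (fun ψ => g.integrable_comp b.continuous _)⟩
  algebraMap_mem' c := ⟨c • 1, P.isIntegral_const c, P'.isIntegral_const c⟩
  star_mem' := by
    rintro f ⟨T, hT, hT'⟩
    exact ⟨star T, hT.star, hT'.star⟩

/-- If the integrals of a point separating algebra of functions with respect to the images of two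
projection valued measures agree, then so do these images. -/
lemma PVM.toFun_preimage_eq [HasOuterApproxClosed X] [MeasurableSpace X] [BorelSpace X]
    (P : PVM S H) (P' : PVM S' H) (a : C(S, X)) (b : C(S', X))
    (hsep : (P.equalIntegrals P' a b).SeparatesPoints) {B : Set X} (hB : MeasurableSet B) :
    P.toFun (a ⁻¹' B) = P'.toFun (b ⁻¹' B) := by
  have hdense := ContinuousMap.starSubalgebra_topologicalClosure_eq_top_of_separatesPoints _ hsep
  refine ContinuousLinearMap.ext_inner_self fun ψ => ?_
  have ha := a.continuous.measurable
  have hb := b.continuous.measurable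
  have hmeas : (P.vecMeasure ψ).map a = (P'.vecMeasure ψ).map b := by
    have key : ∀ g : C(X, ℂ),
        ∫ s, g (a s) ∂(P.vecMeasure ψ) = ∫ s, g (b s) ∂(P'.vecMeasure ψ) := fun g => by
      have hg : g ∈ closure (P.equalIntegrals P' a b : Set C(X, ℂ)) := by
        rw [← StarSubalgebra.topologicalClosure_coe, hdense]
        trivial
      refine (isClosed_eq (ContinuousMap.continuous_integral_comp a.continuous _)
        (ContinuousMap.continuous_integral_comp b.continuous _)).closure_subset_iff.2 ?_ hg
      rintro f ⟨T, hT, hT'⟩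
      exact (hT ψ).symm.trans (hT' ψ)
    refine ext_of_forall_integral_eq_of_IsFiniteMeasure fun f => ?_
    rw [integral_map ha.aemeasurable f.continuous.measurable.aestronglyMeasurable,
      integral_map hb.aemeasurable f.continuous.measurable.aestronglyMeasurable]
    have := key ⟨fun x => (f x : ℂ), by fun_prop⟩
    simp only [ContinuousMap.coe_mk] at this
    rw [integral_complex_ofReal, integral_complex_ofReal] at this
    exact_mod_cast this
  have hr := congrArg (fun m => ((m.real B : ℝ) : ℂ)) hmeas
  simp only [map_measureReal_apply ha hB, map_measureReal_apply hb hB] at hr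
  rwa [P.vecMeasure_real ψ (ha hB), P'.vecMeasure_real ψ (hb hB)] at hr

end Uniqueness

section UniquenessRepresentation

variable {Ω S S' H : Type*} [TopologicalSpace Ω] [T2Space Ω] [LocallyCompactSpace Ω]
  [SecondCountableTopology Ω] [MeasurableSpace Ω] [BorelSpace Ω]
  [TopologicalSpace S] [CompactSpace S] [MeasurableSpace S] [BorelSpace S]
  [TopologicalSpace S'] [CompactSpace S'] [MeasurableSpace S'] [BorelSpace S']
  [NormedAddCommGroup H] [InnerProductSpace ℂ H] [CompleteSpace H]

/-- A representation of a positive operator valued measure is unique up to homeomorphism. -/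
theorem FunctionalPOVM.IsRepresentation.exists_homeomorph {E : FunctionalPOVM Ω H}
    {P : PVM S H} {μ : S → PosBall Ω} {P' : PVM S' H} {μ' : S' → PosBall Ω}
    (h : E.IsRepresentation P μ) (h' : E.IsRepresentation P' μ') :
    ∃ Φ : S ≃ₜ S',
      (∀ A : Set S', MeasurableSet A → P'.toFun A = P.toFun (Φ ⁻¹' A)) ∧ μ = μ' ∘ Φ := by
  -- A common compact target on which both PVMs can be compared.
  let K : Set (PosBall Ω) := Set.range μ ∪ Set.range μ'
  have hK : IsCompact K := (isCompact_range h.continuous).union (isCompact_range h'.continuous)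
  have : CompactSpace K := isCompact_iff_compactSpace.1 hK
  have := PosBall.metrizableSpace_of_isCompact hK
  let _ : MeasurableSpace K := borel K
  have : BorelSpace K := ⟨rfl⟩
  let a : C(S, K) := ⟨fun s => ⟨μ s, Or.inl ⟨s, rfl⟩⟩, h.continuous.subtype_mk _⟩
  let b : C(S', K) := ⟨fun s => ⟨μ' s, Or.inr ⟨s, rfl⟩⟩, h'.continuous.subtype_mk _⟩
  have ha : Function.Injective a := fun x y hxy => h.injective (congrArg Subtype.val hxy)
  have hb : Function.Injective b := fun x y hxy => h'.injective (congrArg Subtype.val hxy)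
  have hsep : (P.equalIntegrals P' a b).SeparatesPoints := fun x y hxy => by
    by_contra! hc
    refine hxy (Subtype.ext (PosBall.ext_pairing fun f => ?_))
    refine hc _ ⟨⟨fun ν : K => ν.1.pairing f,
      (PosBall.continuous_pairing f).comp continuous_subtype_val⟩, ?_, rfl⟩
    exact ⟨_, h.isIntegral f, h'.isIntegral f⟩
  have hPP : ∀ B : Set K, MeasurableSet B → P.toFun (a ⁻¹' B) = P'.toFun (b ⁻¹' B) :=
    fun B hB => P.toFun_preimage_eq P' a b hsep hB
  have hopen : ∀ U : Set S, IsOpen U → P.toFun U = 0 → U = ∅ := fun U hU h0 =>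
    Set.eq_empty_of_forall_notMem fun x hx =>
      (h.support_eq.symm ▸ Set.mem_univ x : x ∈ P.support) U hU hx h0
  have hopen' : ∀ U : Set S', IsOpen U → P'.toFun U = 0 → U = ∅ := fun U hU h0 =>
    Set.eq_empty_of_forall_notMem fun x hx =>
      (h'.support_eq.symm ▸ Set.mem_univ x : x ∈ P'.support) U hU hx h0
  -- The complement of `range a` is open and null for the image of `P`, hence for that of `P'`; full
  -- support of `P'` makes its preimage under `b` empty.
  have hbsub : ∀ s, b s ∈ Set.range a := fun s => by
    have hU : IsOpen (Set.range a)ᶜ := (isCompact_range a.continuous).isClosed.isOpen_compl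
    have h1 := hPP _ hU.measurableSet
    rw [Set.preimage_compl, Set.preimage_range, Set.compl_univ, P.toFun_empty] at h1
    have h2 := hopen' _ (hU.preimage b.continuous) h1.symm
    by_contra hs
    exact (h2 ▸ (show s ∈ b ⁻¹' (Set.range a)ᶜ from hs) : s ∈ (∅ : Set S'))
  have hasub : ∀ s, a s ∈ Set.range b := fun s => by
    have hU : IsOpen (Set.range b)ᶜ := (isCompact_range b.continuous).isClosed.isOpen_compl
    have h1 := hPP _ hU.measurableSet
    rw [Set.preimage_compl (f := b), Set.preimage_range, Set.compl_univ, P'.toFun_empty] at h1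
    have h2 := hopen _ (hU.preimage a.continuous) h1
    by_contra hs
    exact (h2 ▸ (show s ∈ a ⁻¹' (Set.range b)ᶜ from hs) : s ∈ (∅ : Set S))
  have hasurj : Function.Surjective a := by
    rintro ⟨_, ⟨s, rfl⟩ | ⟨s, rfl⟩⟩
    · exact ⟨s, rfl⟩
    · exact hbsub s
  have hbsurj : Function.Surjective b := by
    rintro ⟨_, ⟨s, rfl⟩ | ⟨s, rfl⟩⟩
    · exact hasub s
    · exact ⟨s, rfl⟩
  let α : S ≃ₜ K := Continuous.homeoOfEquivCompactToT2
    (f := Equiv.ofBijective a ⟨ha, hasurj⟩) a.continuous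
  let β : S' ≃ₜ K := Continuous.homeoOfEquivCompactToT2
    (f := Equiv.ofBijective b ⟨hb, hbsurj⟩) b.continuous
  have hα : ∀ s, α s = a s := fun s => rfl
  have hβ : ∀ s, β s = b s := fun s => rfl
  refine ⟨α.trans β.symm, fun A hA => ?_, ?_⟩
  · have hB : MeasurableSet (β.symm ⁻¹' A) := β.symm.continuous.measurable hA
    have h1 := hPP _ hB
    have h2 : b ⁻¹' (β.symm ⁻¹' A) = A := by
      ext s
      simp only [Set.mem_preimage, ← hβ, Homeomorph.symm_apply_apply]
    rw [h2] at h1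
    rw [← h1]
    rfl
  · funext s
    have : b (β.symm (α s)) = a s := by rw [← hβ, Homeomorph.apply_symm_apply, hα]
    exact (congrArg Subtype.val this).symm

end UniquenessRepresentation

/-! ### The double commutant of a commutative POVM -/

namespace FunctionalPOVM

open ZeroAtInftyContinuousMap

variable {Ω H : Type*} [TopologicalSpace Ω] [NormedAddCommGroup H] [InnerProductSpace ℂ H]
  [CompleteSpace H] (E : FunctionalPOVM Ω H)

lemma map_star (f : C₀(Ω, ℂ)) : E.toLinearMap (star f) = star (E.toLinearMap f) := by
  have hreal : ∀ r : C₀(Ω, ℝ), (∀ x, 0 ≤ r x) →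
      star (E.toLinearMap (complexify r)) = E.toLinearMap (complexify r) := fun r hr =>
    (E.isPositive _ fun x => Complex.zero_le_real.2 (hr x)).isSelfAdjoint
  obtain ⟨a, b, c, d, ha, hb, hc, hd, rfl⟩ := exists_eq_complexify f
  have hs : ∀ r : C₀(Ω, ℝ), star (complexify r) = complexify r := fun r => by
    ext x
    simp
  simp only [star_add, star_sub, star_smul, hs, map_add, map_sub, map_smul, hreal a ha,
    hreal b hb, hreal c hc, hreal d hd]

section

variable [T2Space Ω] [LocallyCompactSpace Ω] [SecondCountableTopology Ω]

lemma norm_le_one {f : C₀(Ω, ℂ)} (hf : ∀ x, 0 ≤ f x) (hf' : ∀ x, f x ≤ 1) :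
    ‖E.toLinearMap f‖ ≤ 1 := by
  have hpos := E.isPositive f hf
  refine (CStarAlgebra.norm_le_one_iff_of_nonneg _
    ((ContinuousLinearMap.nonneg_iff_isPositive _).2 hpos)).2 ?_
  rw [ContinuousLinearMap.le_def]
  refine ContinuousLinearMap.isPositive_of_inner_self_nonneg fun ψ => ?_
  obtain ⟨g, hg, hmono, hlim⟩ := exists_monotone_tendsto_one Ω
  have hfre : ∀ x, f x = ((f x).re : ℂ) := fun x =>
    Complex.ext rfl (by simpa using (Complex.le_def.1 (hf x)).2.symm)
  let r : C₀(Ω, ℝ) := mapReal ⟨Complex.re, Complex.continuous_re⟩ rfl f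
  have hr0 : ∀ x, 0 ≤ r x := fun x => (Complex.le_def.1 (hf x)).1
  have hr1 : ∀ x, r x ≤ 1 := fun x => (Complex.le_def.1 (hf' x)).1
  -- These functions dominate `f` and increase to one, so `E(f) ≤ E(Fₙ)` and `E(Fₙ) → 1` weakly give
  -- `E(f) ≤ 1`.
  let F : ℕ → C₀(Ω, ℝ) := fun n =>
    { toFun := fun x => max (r x) (g n x)
      continuous_toFun := (map_continuous r).max (map_continuous (g n))
      zero_at_infty' := by
        have := (zero_at_infty r).max (zero_at_infty (g n))
        rwa [max_self] at this }
  have hF : ∀ n x, F n x = max (r x) (g n x) := fun n x => rfl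
  have ht := E.tendsto_one (fun n => complexify (F n))
    (fun n x => Complex.zero_le_real.2 (le_max_of_le_left (hr0 x)))
    (fun x m n hmn => Complex.real_le_real.2 (max_le_max_left _ (hmono x hmn)))
    (fun x => by
      have h1 := (tendsto_const_nhds (x := r x)).max (hlim x)
      rw [max_eq_right (hr1 x)] at h1
      have h2 := (Complex.continuous_ofReal.tendsto _).comp h1
      rwa [Complex.ofReal_one] at h2) ψ ψ
  rw [_root_.sub_apply, inner_sub_right, one_apply_eq_self]
  refine ge_of_tendsto (ht.sub_const _) (Eventually.of_forall fun n => ?_)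
  rw [← inner_sub_right, ← _root_.sub_apply, ← map_sub]
  refine (E.isPositive _ fun x => ?_).inner_nonneg_right ψ
  rw [ZeroAtInftyContinuousMap.sub_apply, complexify_apply, hfre x, ← Complex.ofReal_sub,
    Complex.zero_le_real, hF]
  exact sub_nonneg.2 (le_max_left _ _)

end

/-- The von Neumann algebra generated by the operators `E(f)`. -/
def doubleCommutant : StarSubalgebra ℂ (H →L[ℂ] H) :=
  StarSubalgebra.centralizer ℂ
    (StarSubalgebra.centralizer ℂ (Set.range E.toLinearMap) : Set (H →L[ℂ] H))

/-- The range of `E` is closed under adjoints, so the star-algebra centralizer imposes nothing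
beyond the plain commutant. -/
lemma mem_centralizer_iff {T : H →L[ℂ] H} :
    T ∈ StarSubalgebra.centralizer ℂ (Set.range E.toLinearMap) ↔ T ∈ E.commutant := by
  rw [StarSubalgebra.mem_centralizer_iff]
  constructor
  · intro h g hg
    exact (h g hg).1
  · rintro h _ ⟨f, rfl⟩
    exact ⟨h _ ⟨f, rfl⟩, by rw [← E.map_star]; exact h _ ⟨_, rfl⟩⟩

lemma mem_doubleCommutant_iff {T : H →L[ℂ] H} :
    T ∈ E.doubleCommutant ↔ ∀ R ∈ E.commutant, R * T = T * R := by
  rw [doubleCommutant, StarSubalgebra.mem_centralizer_iff]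
  constructor
  · intro h R hR
    exact (h R (E.mem_centralizer_iff.2 hR)).1
  · intro h R hR
    exact ⟨h R (E.mem_centralizer_iff.1 hR),
      h _ (E.mem_centralizer_iff.1 (star_mem hR))⟩

lemma toLinearMap_mem_doubleCommutant (f : C₀(Ω, ℂ)) : E.toLinearMap f ∈ E.doubleCommutant :=
  E.mem_doubleCommutant_iff.2 fun _ hR => (hR _ ⟨f, rfl⟩).symm

instance isClosed_doubleCommutant : IsClosed (E.doubleCommutant : Set (H →L[ℂ] H)) := by
  rw [doubleCommutant, StarSubalgebra.coe_centralizer]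
  exact Set.isClosed_centralizer _

variable {E} in
-- Commutativity gives `E(f) ∈ E'`, so every element of `E''` commutes with all `E(f)` and thus lies
-- in `E'`, with which `E''` commutes.
lemma IsCommutative.mul_comm (hE : E.IsCommutative) {S T : H →L[ℂ] H}
    (hS : S ∈ E.doubleCommutant) (hT : T ∈ E.doubleCommutant) : S * T = T * S := by
  refine E.mem_doubleCommutant_iff.1 hT S ?_
  rintro _ ⟨f, rfl⟩
  exact E.mem_doubleCommutant_iff.1 hS _ (hE f)

variable {E} in
/-- For commutative `E`, the double commutant is a commutative `C⋆`-algebra. -/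
abbrev IsCommutative.commCStarAlgebra (hE : E.IsCommutative) :
    CommCStarAlgebra E.doubleCommutant where
  mul_comm S T := Subtype.ext (hE.mul_comm S.2 T.2)

/-! ### Characters as measures, and existence -/

variable [T2Space Ω] [LocallyCompactSpace Ω] [SecondCountableTopology Ω] [MeasurableSpace Ω]
  [BorelSpace Ω]

/-- A character of the double commutant gives a measure on `Ω`. -/
lemma exists_posBall_pairing_eq (χ : E.doubleCommutant →ₐ[ℂ] ℂ) :
    ∃ ν : PosBall Ω, ∀ f : C₀(Ω, ℂ),
      ν.pairing f = χ ⟨E.toLinearMap f, E.toLinearMap_mem_doubleCommutant f⟩ := by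
  let Λ : C₀(Ω, ℂ) →ₗ[ℂ] ℂ :=
    χ.toLinearMap ∘ₗ E.toLinearMap.codRestrict E.doubleCommutant.toSubalgebra.toSubmodule
      E.toLinearMap_mem_doubleCommutant
  -- Values of a character lie in the spectrum, which is the same in `E''` as in all bounded
  -- operators. Positivity and the norm bound for `Λ` follow from those for `E`.
  have hmem : ∀ f, Λ f ∈ spectrum ℂ (E.toLinearMap f) := fun f => by
    have := AlgHom.apply_mem_spectrum χ
      ⟨E.toLinearMap f, E.toLinearMap_mem_doubleCommutant f⟩
    rwa [StarSubalgebra.spectrum_eq] at this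
  obtain ⟨ν, hν, hν'⟩ := exists_measure_of_positive Λ 1
    (fun f hf => spectrum_nonneg_of_nonneg
      ((ContinuousLinearMap.nonneg_iff_isPositive _).2 (E.isPositive f hf)) (hmem f))
    (fun f hf hf' => by
      refine (spectrum.norm_le_norm_mul_of_mem (hmem f)).trans ?_
      exact mul_le_one₀ (E.norm_le_one hf hf') (norm_nonneg _) ContinuousLinearMap.norm_id_le)
  exact ⟨⟨ν, by simpa using hν⟩, fun f => (hν' f).symm⟩

variable {E} in
/-- A commutative positive operator valued measure is represented by a projection valued measure
on a compact set of measures. -/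
theorem IsCommutative.exists_representation (hE : E.IsCommutative) :
    ∃ K : Set (PosBall Ω), IsCompact K ∧ ∀ [MeasurableSpace K] [BorelSpace K],
      ∃ P : PVM K H, E.IsRepresentation P Subtype.val ∧ P.commutant = E.commutant := by
  let _ := hE.commCStarAlgebra
  let Z := WeakDual.characterSpace ℂ E.doubleCommutant
  choose m hm using fun χ : Z =>
    E.exists_posBall_pairing_eq (WeakDual.CharacterSpace.equivAlgHom χ)
  have hmc : Continuous m := PosBall.continuous_iff.2 fun f => by
    simp only [hm]
    exact (WeakDual.gelfandTransform ℂ E.doubleCommutant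
      ⟨E.toLinearMap f, E.toLinearMap_mem_doubleCommutant f⟩).continuous
  have hK : IsCompact (Set.range m) := isCompact_range hmc
  refine ⟨Set.range m, hK, ?_⟩
  intro _ _
  have : CompactSpace (Set.range m) := isCompact_iff_compactSpace.1 hK
  have := PosBall.metrizableSpace_of_isCompact hK
  let m' : C(Z, Set.range m) := ⟨Set.rangeFactorization m, hmc.subtype_mk _⟩
  -- Pull back along `m'` to `C(Z)`, undo the Gelfand transform, and include `E''` in the bounded
  -- operators. Surjectivity of `m'` makes `π` injective.
  let π : C(Set.range m, ℂ) →⋆ₐ[ℂ] (H →L[ℂ] H) :=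
    E.doubleCommutant.subtype.comp
      (((gelfandStarTransform E.doubleCommutant).symm : _ →⋆ₐ[ℂ] E.doubleCommutant).comp
        (m'.compStarAlgHom' ℂ ℂ))
  have hπmem : ∀ g, π g ∈ E.doubleCommutant := fun g => Subtype.prop _
  have hπinj : ∀ g, π g = 0 → g = 0 := fun g hg => by
    have h1 : (gelfandStarTransform E.doubleCommutant).symm (g.comp m') = 0 := Subtype.ext hg
    have h2 : g.comp m' = 0 := by
      rw [← (gelfandStarTransform E.doubleCommutant).apply_symm_apply (g.comp m'), h1, map_zero]
    ext ⟨_, χ, rfl⟩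
    exact DFunLike.congr_fun h2 χ
  let ev : C₀(Ω, ℂ) → C(Set.range m, ℂ) := fun f =>
    ⟨fun ν => ν.1.pairing f, (PosBall.continuous_pairing f).comp continuous_subtype_val⟩
  have hπev : ∀ f, π (ev f) = E.toLinearMap f := fun f => by
    have h1 : (ev f).comp m' = gelfandStarTransform E.doubleCommutant
        ⟨E.toLinearMap f, E.toLinearMap_mem_doubleCommutant f⟩ := by
      ext χ
      exact hm χ f
    change (((gelfandStarTransform E.doubleCommutant).symm ((ev f).comp m') :
      E.doubleCommutant) : H →L[ℂ] H) = _
    rw [h1, StarAlgEquiv.symm_apply_apply]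
  obtain ⟨P, hP⟩ := exists_PVM_of_starAlgHom π
  refine ⟨P, ⟨?_, continuous_subtype_val, Subtype.val_injective, fun f => ?_⟩, ?_⟩
  -- If `P(U) = 0`, a Urysohn function supported in `U` with value one at `x` has zero integral,
  -- contradicting injectivity of `π`.
  · refine Set.eq_univ_of_forall fun x U hU hx h0 => ?_
    obtain ⟨g, hg0, hg1, -⟩ := exists_continuous_zero_one_of_isClosed hU.isClosed_compl
      (isClosed_singleton (x := x)) (by simpa using hx)
    let g' : C(Set.range m, ℂ) := ⟨fun y => (g y : ℂ), by fun_prop⟩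
    have hg' : π g' = 0 := ContinuousLinearMap.ext_inner_self fun ψ => by
      rw [hP g' ψ, _root_.zero_apply, inner_zero_right]
      refine integral_eq_zero_of_ae ?_
      have hU0 : P.vecMeasure ψ U = 0 := by
        rw [P.vecMeasure_apply ψ hU.measurableSet, h0]
        simp
      filter_upwards [measure_eq_zero_iff_ae_notMem.1 hU0] with y hy
      simp [g', hg0 hy]
    have := DFunLike.congr_fun (hπinj g' hg') x
    simp [g', hg1 rfl] at this
  · rw [← hπev f]
    exact hP (ev f)
  · apply Set.Subset.antisymm
    · rintro T hT _ ⟨f, rfl⟩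
      -- On the compact space `range m`, every continuous function vanishes at infinity, so `ev f`
      -- is an admissible integrand.
      refine hT _ ⟨ContinuousMap.liftZeroAtInfty (ev f), ?_⟩
      rw [← hπev f]
      exact hP (ev f)
    · rintro T hT R ⟨φ, hφ⟩
      rw [hφ.unique (hP φ.toContinuousMap)]
      exact (E.mem_doubleCommutant_iff.1 (hπmem _) T hT).symm

end FunctionalPOVM

end

theorem theorem1 {Ω : Type u} [TopologicalSpace Ω] [T2Space Ω] [LocallyCompactSpace Ω]
    [SecondCountableTopology Ω] [MeasurableSpace Ω] [BorelSpace Ω]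
    {H : Type v} [NormedAddCommGroup H] [InnerProductSpace ℂ H] [CompleteSpace H]
    [TopologicalSpace.SeparableSpace H]
    (E : FunctionalPOVM Ω H) (hE : E.IsCommutative) :
    ∃ (S : Type u) (_ : TopologicalSpace S) (_ : CompactSpace S)
      (_ : TopologicalSpace.MetrizableSpace S) (_ : MeasurableSpace S) (_ : BorelSpace S)
      (P : PVM S H) (μ : S → PosBall Ω),
      E.IsRepresentation P μ ∧
      (∀ (S' : Type w) [TopologicalSpace S'] [CompactSpace S']
        [TopologicalSpace.MetrizableSpace S'] [MeasurableSpace S'] [BorelSpace S']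
        (P' : PVM S' H) (μ' : S' → PosBall Ω), E.IsRepresentation P' μ' →
        ∃ Φ : S ≃ₜ S',
          (∀ A : Set S', MeasurableSet A → P'.toFun A = P.toFun (Φ ⁻¹' A)) ∧ μ = μ' ∘ Φ) ∧
      P.commutant = E.commutant := by
  obtain ⟨K, hK, hrep⟩ := hE.exists_representation
  let _ : MeasurableSpace K := borel K
  have hB : BorelSpace K := ⟨rfl⟩
  obtain ⟨P, hP, hcomm⟩ := hrep
  exact ⟨K, inferInstance, isCompact_iff_compactSpace.1 hK,
    PosBall.metrizableSpace_of_isCompact hK, inferInstance, hB, P, Subtype.val, hP,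
    fun S' _ _ _ _ _ P' μ' h' =>
      have : CompactSpace K := isCompact_iff_compactSpace.1 hK
      hP.exists_homeomorph h',
    hcomm⟩
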